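/- Let $d\ge 1$, $\gamma>0$ and $C_2>0$. There are constants $C,K>0$, depending only on $d,\gamma,C_2$, with the following property. Let $\beta,L>0$ and let $p_0$ be a probability density on $\mathbb{R}^d$ such that $$p_0(x)\le \frac{C_2}{(1+\|x\|^2)^{(1+\gamma+d)/2}}$$ (polynomial tails) and, for every multi-index $\alpha\in\mathbb{N}_0^d$ with $\sum_i\alpha_i=\beta$, $$\int_{\mathbb{R}^d}|\omega^\alpha|^2\,|\mathcal F[p_0](\omega)|^2\,d\omega\le(2\pi)^dL^2,\qquad \mathcal F[p_0](\omega)=\int_{\mathbb{R}^d} p_0(x)e^{-i\langle\omega,x\rangle}\,dx$$ (Sobolev regularity). For $t>0$ let $\varphi_t(x)=(2\pi t)^{-d/2}\exp(-\|x\|^2/(2t))$, $p_t=\varphi_t*p_0$ and $s_t=\nabla\log p_t$. Let $n\ge 2$, let $X^{(1)},\dots,X^{(n)}$ be i.i.d. with density $p_0$, and put $$\hat p_t(x)=\frac1n\sum_{i=1}^n\varphi_t(x-X^{(i)}),\qquad \nabla\hat p_t(x)=\frac1{nt}\sum_{i=1}^n(X^{(i)}-x)\,\varphi_t(x-X^{(i)}),$$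 $$\hat s_t(x)=\frac{\nabla\hat p_t(x)}{\hat p_t(x)}\,\mathbf 1\{\hat p_t(x)\ge\rho_n\},\qquad \rho_n=\frac{\log n}{n(2\pi t)^{d/2}}.$$ Then for all $0<t_0<T$, $$\int_{t_0}^T\mathbb E\Big[\int_{\mathbb{R}^d}\|\hat s_t(x)-s_t(x)\|^2p_t(x)\,dx\Big]dt\;\le\; C\,A(t_0,T)\,(\log n)^{K}\,n^{-\frac{\gamma+1}{d+\gamma+1}}\,t_0^{-\frac{d(\gamma+1)}{2(d+\gamma+1)}},$$ where $$A(t_0,T)=\bigl(1+\log\max(1,T)\bigr)\,\max(1,t_0)^{\frac{d(\gamma+1)}{2(d+\gamma+1)}}.$$ In particular, $A(t_0,T)$ is bounded by a constant depending only on $d,\gamma,T$, and $A(t_0,T)=1+\log\max(1,T)$ if $t_0\le1$. So for fixed $T$ the integrated error is, uniformly in $t_0\in(0,T)$ and in $n\ge 2$, at most a constant times $(\log n)^{K}n^{-\frac{\gamma+1}{d+\gamma+1}}t_0^{-\frac{d(\gamma+1)}{2(d+\gamma+1)}}$. -/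

import Mathlib

open MeasureTheory ProbabilityTheory
open scoped ENNReal

noncomputable section

namespace ScoreEstimation

/-- Polynomial tail decay with index `γ` and constant `C` of a density on `ℝ^d`
(densities are only determined almost everywhere). -/
def PolynomialTail (d : ℕ) (γ C : ℝ) (p : EuclideanSpace ℝ (Fin d) → ℝ) : Prop :=
  ∀ᵐ x, p x ≤ C / (1 + ‖x‖ ^ 2) ^ ((1 + γ + d) / 2)

/-- The Fourier transform `∫ f(x) exp(-i ⟨ω, x⟩) dx`. -/
def fourierTransform (d : ℕ) (f : EuclideanSpace ℝ (Fin d) → ℝ)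
    (ω : EuclideanSpace ℝ (Fin d)) : ℂ :=
  ∫ x, (f x : ℂ) * Complex.exp (-(Complex.I * ((inner ℝ ω x : ℝ) : ℂ)))

/-- The Sobolev class of probability densities on `ℝ^d` with smoothness `β` and radius `L`. -/
structure SobolevDensity (d : ℕ) (β L : ℝ) (p : EuclideanSpace ℝ (Fin d) → ℝ) : Prop where
  integrable : Integrable p
  nonneg : ∀ᵐ x, 0 ≤ p x
  integral_eq_one : ∫ x, p x = 1
  sobolev : ∀ α : Fin d → ℕ, ((∑ i, α i : ℕ) : ℝ) = β →
    ∫⁻ ω : EuclideanSpace ℝ (Fin d),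
        ENNReal.ofReal (|∏ i, ω i ^ α i| ^ 2 * ‖fourierTransform d p ω‖ ^ 2)
      ≤ ENNReal.ofReal ((2 * Real.pi) ^ d * L ^ 2)

/-- The probability measure with density `p` with respect to Lebesgue measure. -/
def densityMeasure (d : ℕ) (p : EuclideanSpace ℝ (Fin d) → ℝ) :
    Measure (EuclideanSpace ℝ (Fin d)) :=
  volume.withDensity fun x => ENNReal.ofReal (p x)

/-- The Gaussian transition density `φ_t`, the density of `N(0, t I_d)`. -/
def heatKernel (d : ℕ) (t : ℝ) (x : EuclideanSpace ℝ (Fin d)) : ℝ :=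
  1 / (2 * Real.pi * t) ^ ((d : ℝ) / 2) * Real.exp (-‖x‖ ^ 2 / (2 * t))

/-- The density `p_t = φ_t * p₀` of `X₀ + √t Z`, with `X₀ ∼ p₀` and `Z ∼ N(0, I_d)` independent. -/
def diffusedDensity (d : ℕ) (p₀ : EuclideanSpace ℝ (Fin d) → ℝ) (t : ℝ)
    (x : EuclideanSpace ℝ (Fin d)) : ℝ :=
  ∫ y, heatKernel d t (x - y) * p₀ y

/-- The score function `s_t = ∇ log p_t`. -/
def score (d : ℕ) (p₀ : EuclideanSpace ℝ (Fin d) → ℝ) (t : ℝ)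
    (x : EuclideanSpace ℝ (Fin d)) : EuclideanSpace ℝ (Fin d) :=
  gradient (fun y => Real.log (diffusedDensity d p₀ t y)) x

/-- The Gaussian kernel density estimator `p̂_t` built from the data `X 0, …, X (n - 1)`. -/
def kde (d n : ℕ) (t : ℝ) (X : Fin n → EuclideanSpace ℝ (Fin d))
    (x : EuclideanSpace ℝ (Fin d)) : ℝ :=
  1 / (n : ℝ) * ∑ i, heatKernel d t (x - X i)

/-- The gradient `∇ p̂_t` of the Gaussian kernel density estimator. -/
def gradKde (d n : ℕ) (t : ℝ) (X : Fin n → EuclideanSpace ℝ (Fin d))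
    (x : EuclideanSpace ℝ (Fin d)) : EuclideanSpace ℝ (Fin d) :=
  (1 / ((n : ℝ) * t)) • ∑ i, heatKernel d t (x - X i) • (X i - x)

/-- The truncation level `ρ_n = log n / (n (2 π t)^(d/2))`. -/
def threshold (d n : ℕ) (t : ℝ) : ℝ :=
  Real.log n / (n * (2 * Real.pi * t) ^ ((d : ℝ) / 2))

open Classical in
/-- The thresholded score estimator `ŝ_t`. -/
def scoreEstimator (d n : ℕ) (t : ℝ) (X : Fin n → EuclideanSpace ℝ (Fin d))
    (x : EuclideanSpace ℝ (Fin d)) : EuclideanSpace ℝ (Fin d) :=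
  if threshold d n t ≤ kde d n t X x then (kde d n t X x)⁻¹ • gradKde d n t X x else 0

/-- The integrated score error `∫_{t₀}^T E ∫ ‖ŝ_t(x) - s_t(x)‖² p_t(x) dx dt`, as an element of
`[0, ∞]`. The expectation is over the data `X`. -/
def integratedScoreError (d n : ℕ) (p₀ : EuclideanSpace ℝ (Fin d) → ℝ) {Ω : Type*}
    [MeasurableSpace Ω] (P : Measure Ω) (X : Fin n → Ω → EuclideanSpace ℝ (Fin d))
    (t₀ T : ℝ) : ℝ≥0∞ :=
  ∫⁻ t in Set.Icc t₀ T, ∫⁻ ω, ∫⁻ x,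
    ENNReal.ofReal (‖scoreEstimator d n t (fun i => X i ω) x - score d p₀ t x‖ ^ 2
      * diffusedDensity d p₀ t x) ∂volume ∂P

end ScoreEstimation

end

/-! Write w = exp(-‖x - y‖²/(2t)), u = E w for the population Gaussian mass and W for its sum over
the sample. The score is E[w(y - x)]/(tu), the estimator is the same quotient for the sample, and
after cancelling normalisations the threshold reads W ≥ log n. Since ‖x - y‖² = 2t log(1/w), second
moments are entropies, and the tangent line of -w log w at any c > 0 gives w‖x - y‖² ≤ 2t(w log(1/c)
+ c - w). Freedom in c drives everything: c = 1/n shows that ‖ŝ‖² ≲ log n / t, c = u bounds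
variances, and a spatially decaying c makes the bound integrable in the tails.

At a point with nu ≥ 2 log n, either W ≥ nu/2, and ŝ - s is exactly a sum of centred i.i.d. vectors
divided by tW, or W < nu/2, where the crude bound is paid for by a Chebyshev factor. Both give an
expected error, weighted by u, of order log n/(tn) (`lintegral_norm_sub_sq_mul_le_of_le_gaussMass`).
Elsewhere no probability is needed: `norm_sub_sq_mul_le_of_entropy` is deterministic.

The diffused density keeps the tail ‖x‖^(-q), q = 1 + γ + d, up to max(1,t)^((1+γ)/2)
(`exists_diffusedDensity_tail`). With r the radius where this tail reaches the level ρ_n, min(p_t,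
2ρ_n) ≲ ρ_n (1 + ‖x‖/r)^(-q). Hence in both regimes the error is at most a constant times (log n/t)
ρ_n (1 + ‖x‖/r)^(-(q-1)) (`lintegral_norm_sub_sq_mul_le`), and q - 1 > d makes it integrable. The
spatial integral is of order (log n/t) ρ_n r^d, which is the rate (`threshold_mul_pow_le`);
integrating in t finishes. -/

noncomputable section

namespace ScoreEstimation

/-! ### Gaussian weights and the entropy bound on second moments -/

section GaussianWeight

variable {E : Type*} [NormedAddCommGroup E]

/-- The unnormalised Gaussian `exp (-‖z‖² / (2t))`. -/
def gaussWeight (t : ℝ) (z : E) : ℝ := Real.exp (-‖z‖ ^ 2 / (2 * t))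

lemma gaussWeight_pos (t : ℝ) (z : E) : 0 < gaussWeight t z := Real.exp_pos _

lemma gaussWeight_le_one {t : ℝ} (ht : 0 < t) (z : E) : gaussWeight t z ≤ 1 := by
  refine Real.exp_le_one_iff.2 ?_
  rw [neg_div]
  exact neg_nonpos.2 (by positivity)

@[fun_prop]
lemma continuous_gaussWeight (t : ℝ) : Continuous (gaussWeight t : E → ℝ) := by
  unfold gaussWeight
  fun_prop

/-- Tangent line inequality for the entropy: `w log (1/w) ≤ w log (1/c) + c - w`. -/
lemma gaussWeight_mul_norm_sq_le {t c : ℝ} (ht : 0 < t) (hc : 0 < c) (z : E) :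
    gaussWeight t z * ‖z‖ ^ 2 ≤
      2 * t * (gaussWeight t z * (-Real.log c) + c - gaussWeight t z) := by
  have hw := gaussWeight_pos t z
  have h1 : ‖z‖ ^ 2 = 2 * t * (-Real.log (gaussWeight t z)) := by
    rw [gaussWeight, Real.log_exp]
    field_simp
  have h2 := Real.log_le_sub_one_of_pos (div_pos hc hw)
  rw [Real.log_div hc.ne' hw.ne'] at h2
  have h3 := mul_le_mul_of_nonneg_left h2 hw.le
  have h4 : gaussWeight t z * (c / gaussWeight t z - 1) = c - gaussWeight t z := by
    field_simp
  rw [h1]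
  nlinarith

lemma gaussWeight_mul_norm_sq_le' {t : ℝ} (ht : 0 < t) (z : E) :
    gaussWeight t z * ‖z‖ ^ 2 ≤ 2 * t := by
  have := gaussWeight_mul_norm_sq_le ht one_pos z
  have h2 := gaussWeight_pos t z
  simp only [Real.log_one, neg_zero, mul_zero, zero_add] at this
  nlinarith

lemma gaussWeight_mul_norm_le {t : ℝ} (ht : 0 < t) (z : E) :
    gaussWeight t z * ‖z‖ ≤ 1 + 2 * t := by
  have h := gaussWeight_mul_norm_sq_le' ht z
  have h2 := gaussWeight_pos t z
  have h1 := gaussWeight_le_one ht z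
  nlinarith [sq_nonneg (‖z‖ - 1)]

lemma norm_gaussWeight_smul_le {t : ℝ} [NormedSpace ℝ E] (ht : 0 < t) (x y : E) :
    ‖gaussWeight t (x - y) • (y - x)‖ ≤ 1 + 2 * t := by
  rw [norm_smul, Real.norm_of_nonneg (gaussWeight_pos _ _).le, norm_sub_rev y x]
  exact gaussWeight_mul_norm_le ht _

variable [MeasurableSpace E]

/-- The convolution of `ν` with the unnormalised Gaussian. -/
def gaussMass (ν : Measure E) (t : ℝ) (x : E) : ℝ := ∫ y, gaussWeight t (x - y) ∂ν

/-- The first moment of `ν`, centred at `x`, against the Gaussian weight. -/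
def gaussMoment [NormedSpace ℝ E] (ν : Measure E) (t : ℝ) (x : E) : E :=
  ∫ y, gaussWeight t (x - y) • (y - x) ∂ν

variable [BorelSpace E] [SecondCountableTopology E] (ν : Measure E) [IsProbabilityMeasure ν]
  {t : ℝ} (ht : 0 < t) (x : E)
include ht

lemma integrable_gaussWeight : Integrable (fun y => gaussWeight t (x - y)) ν := by
  refine Integrable.of_bound (C := 1) (by fun_prop) (.of_forall fun y => ?_)
  rw [Real.norm_of_nonneg (gaussWeight_pos _ _).le]
  exact gaussWeight_le_one ht _

lemma integrable_gaussWeight_mul_norm_sq :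
    Integrable (fun y => gaussWeight t (x - y) * ‖x - y‖ ^ 2) ν := by
  refine Integrable.of_bound (C := 2 * t) (by fun_prop) (.of_forall fun y => ?_)
  rw [Real.norm_of_nonneg (mul_nonneg (gaussWeight_pos _ _).le (sq_nonneg _))]
  exact gaussWeight_mul_norm_sq_le' ht _

lemma integrable_gaussWeight_smul [NormedSpace ℝ E] :
    Integrable (fun y => gaussWeight t (x - y) • (y - x)) ν :=
  Integrable.of_bound (C := 1 + 2 * t) (by fun_prop)
    (.of_forall fun y => norm_gaussWeight_smul_le ht x y)

lemma gaussMass_pos : 0 < gaussMass ν t x := by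
  rw [gaussMass, integral_pos_iff_support_of_nonneg (fun y => (gaussWeight_pos _ _).le)
    (integrable_gaussWeight ν ht x)]
  have : Function.support (fun y => gaussWeight t (x - y)) = Set.univ :=
    Set.eq_univ_of_forall fun y => (gaussWeight_pos _ _).ne'
  simp [this]

lemma gaussMass_le_one : gaussMass ν t x ≤ 1 := by
  have := integral_mono (integrable_gaussWeight ν ht x) (integrable_const (1 : ℝ))
    (fun y => gaussWeight_le_one ht (x - y))
  simpa [gaussMass] using this

/-- The second moment against the Gaussian weight is controlled by an entropy. -/
lemma integral_gaussWeight_mul_norm_sq_le {c : ℝ} (hc : 0 < c) :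
    ∫ y, gaussWeight t (x - y) * ‖x - y‖ ^ 2 ∂ν ≤
      2 * t * (gaussMass ν t x * (-Real.log c) + c - gaussMass ν t x) := by
  have hi := integrable_gaussWeight ν ht x
  have h := integral_mono (integrable_gaussWeight_mul_norm_sq ν ht x)
    ((((hi.mul_const (-Real.log c)).add (integrable_const c)).sub hi).const_mul (2 * t))
    (fun y => gaussWeight_mul_norm_sq_le ht hc (x - y))
  refine h.trans_eq ?_
  simp only [Pi.add_apply, Pi.sub_apply]
  rw [integral_const_mul, integral_sub (by fun_prop) hi, integral_add (by fun_prop) (by fun_prop),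
    integral_mul_const]
  simp [gaussMass]

end GaussianWeight

/-! ### Gaussian tilts: variance, Cauchy–Schwarz, gradient -/

section InnerProduct

variable {E : Type*} [NormedAddCommGroup E] [InnerProductSpace ℝ E] [MeasurableSpace E]
  [BorelSpace E] [FiniteDimensional ℝ E] (ν : Measure E) [IsProbabilityMeasure ν]
  {t : ℝ} (ht : 0 < t) (x : E)
include ht

/-- Variance decomposition under the Gaussian tilt of `ν`. -/
lemma integral_gaussWeight_mul_norm_sub_sq :
    ∫ y, gaussWeight t (x - y) *
        ‖y - x - (gaussMass ν t x)⁻¹ • gaussMoment ν t x‖ ^ 2 ∂ν =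
      (∫ y, gaussWeight t (x - y) * ‖x - y‖ ^ 2 ∂ν) -
        (gaussMass ν t x)⁻¹ * ‖gaussMoment ν t x‖ ^ 2 := by
  set u := gaussMass ν t x with hu
  set v := gaussMoment ν t x with hv
  have hu0 : 0 < u := gaussMass_pos ν ht x
  have hi := integrable_gaussWeight ν ht x
  have hi1 := integrable_gaussWeight_smul ν ht x
  have hi2 := integrable_gaussWeight_mul_norm_sq ν ht x
  have hi3 : Integrable (fun y => inner ℝ v (gaussWeight t (x - y) • (y - x))) ν :=
    hi1.const_inner v
  have key : ∀ y, gaussWeight t (x - y) * ‖y - x - u⁻¹ • v‖ ^ 2 =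
      gaussWeight t (x - y) * ‖x - y‖ ^ 2
        - (2 * u⁻¹) * inner ℝ v (gaussWeight t (x - y) • (y - x))
        + gaussWeight t (x - y) * (u⁻¹ ^ 2 * ‖v‖ ^ 2) := by
    intro y
    rw [@norm_sub_sq_real, inner_smul_right, inner_smul_right, norm_smul,
      Real.norm_of_nonneg (inv_nonneg.2 hu0.le), real_inner_comm v, norm_sub_rev y x]
    ring
  simp_rw [key]
  rw [integral_add (by fun_prop) (by fun_prop), integral_sub hi2 (by fun_prop),
    integral_const_mul, integral_mul_const, integral_inner hi1]
  change _ - _ * inner ℝ v v + u * _ = _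
  rw [real_inner_self_eq_norm_sq]
  field_simp
  ring

/-- Cauchy–Schwarz, read off from nonnegativity of the tilted variance. -/
lemma norm_gaussMoment_sq_le :
    ‖gaussMoment ν t x‖ ^ 2 ≤
      gaussMass ν t x * ∫ y, gaussWeight t (x - y) * ‖x - y‖ ^ 2 ∂ν := by
  have h0 : 0 ≤ ∫ y, gaussWeight t (x - y) *
        ‖y - x - (gaussMass ν t x)⁻¹ • gaussMoment ν t x‖ ^ 2 ∂ν :=
    integral_nonneg fun y => mul_nonneg (gaussWeight_pos _ _).le (sq_nonneg _)
  rw [integral_gaussWeight_mul_norm_sub_sq ν ht x] at h0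
  have hu := gaussMass_pos ν ht x
  have := mul_nonneg hu.le h0
  rw [mul_sub, ← mul_assoc, mul_inv_cancel₀ hu.ne', one_mul] at this
  linarith

/-- Differentiation under the integral; the gradient of the weight is bounded by a constant, which
is integrable for a probability measure. -/
lemma hasGradientAt_gaussMass :
    HasGradientAt (gaussMass ν t) (t⁻¹ • gaussMoment ν t x) x := by
  have hd : ∀ y z : E, HasGradientAt (fun z => gaussWeight t (z - y))
      (t⁻¹ • (gaussWeight t (z - y) • (y - z))) z := by
    intro y z
    have h1 : HasFDerivAt (fun z : E => -‖z - y‖ ^ 2 / (2 * t))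
        ((2 * t)⁻¹ • (-((2 : ℝ) • (innerSL ℝ (z - y)).comp (ContinuousLinearMap.id ℝ E)))) z := by
      have := (((hasFDerivAt_id z).sub_const y).norm_sq).neg.const_mul (2 * t)⁻¹
      refine this.congr_of_eventuallyEq (.of_forall fun z => ?_) |>.congr_fderiv ?_
      · simp [div_eq_inv_mul]
      · ext; simp
    have h2 := h1.exp
    rw [hasGradientAt_iff_hasFDerivAt]
    refine h2.congr_fderiv ?_
    ext k
    simp only [gaussWeight, InnerProductSpace.toDual_apply_apply, inner_smul_left,
      smul_apply, neg_apply,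
      ContinuousLinearMap.comp_apply, ContinuousLinearMap.id_apply, innerSL_apply_apply,
      smul_eq_mul]
    rw [← neg_sub z y, inner_neg_left]
    simp only [conj_trivial]
    field_simp
  have hb : ∀ y z : E, ‖t⁻¹ • (gaussWeight t (z - y) • (y - z))‖ ≤ t⁻¹ * (1 + 2 * t) := by
    intro y z
    rw [norm_smul, Real.norm_of_nonneg (inv_nonneg.2 ht.le)]
    exact mul_le_mul_of_nonneg_left (norm_gaussWeight_smul_le ht z y) (inv_nonneg.2 ht.le)
  have := hasFDerivAt_integral_of_dominated_of_fderiv_le (𝕜 := ℝ) (μ := ν)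
    (F := fun z y => gaussWeight t (z - y)) (x₀ := x) (s := Set.univ)
    (F' := fun z y => InnerProductSpace.toDual ℝ E (t⁻¹ • (gaussWeight t (z - y) • (y - z))))
    (bound := fun _ => t⁻¹ * (1 + 2 * t)) Filter.univ_mem
    (.of_forall fun z => by fun_prop) (integrable_gaussWeight ν ht x)
    (by
      refine (InnerProductSpace.toDual ℝ E).continuous.comp_aestronglyMeasurable ?_
      fun_prop)
    (.of_forall fun y z _ => by
      rw [LinearIsometryEquiv.norm_map]; exact hb y z)
    (integrable_const _)
    (.of_forall fun y z _ => (hd y z).hasFDerivAt)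
  rw [hasGradientAt_iff_hasFDerivAt]
  refine this.congr_fderiv ?_
  have h4 := ((InnerProductSpace.toDual ℝ E).toLinearIsometry.toContinuousLinearMap).integral_comp_comm
    (μ := ν) ((integrable_gaussWeight_smul ν ht x).smul t⁻¹)
  simp only [Pi.smul_apply, integral_smul] at h4
  exact h4

end InnerProduct

/-! ### Second moments of centred i.i.d. sums -/

section SecondMoment

variable {E : Type*} [MeasurableSpace E] (ν : Measure E) [IsProbabilityMeasure ν]

lemma integrable_comp_eval_pi {n : ℕ} {f : E → ℝ} (hf : Integrable f ν) (i : Fin n) :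
    Integrable (fun z : Fin n → E => f (z i)) (Measure.pi fun _ => ν) :=
  (measurePreserving_eval (fun _ : Fin n => ν) i).integrable_comp_of_integrable hf

/-- The second moment of a sum of centred i.i.d. real random variables. -/
lemma integral_sum_sq_pi (n : ℕ) {f : E → ℝ} (hf : MemLp f 2 ν) (h0 : ∫ y, f y ∂ν = 0) :
    ∫ z, (∑ i : Fin n, f (z i)) ^ 2 ∂(Measure.pi fun _ => ν) = n * ∫ y, f y ^ 2 ∂ν := by
  have hint : Integrable f ν := hf.integrable one_le_two
  have h := variance_sum_pi (μ := fun _ : Fin n => ν) (X := fun _ => f) (fun _ => hf)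
  have hz : ∀ i : Fin n, ∫ z, f (z i) ∂(Measure.pi fun _ : Fin n => ν) = 0 := fun i => by
    rw [← h0]
    exact integral_comp_eval (μ := fun _ : Fin n => ν) (i := i) hint.aestronglyMeasurable
  have hm : AEMeasurable (∑ i, fun z : Fin n → E => f (z i)) (Measure.pi fun _ => ν) :=
    Finset.aemeasurable_sum _ fun i _ => (integrable_comp_eval_pi ν hint i).aemeasurable
  rw [variance_of_integral_eq_zero hm, variance_of_integral_eq_zero hint.aemeasurable h0] at h
  · simpa using h
  · simp only [Finset.sum_apply]
    rw [integral_finsetSum _ fun i _ => integrable_comp_eval_pi ν hint i]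
    simp [hz]

variable {d : ℕ}

/-- The second moment of a sum of bounded centred i.i.d. random vectors. -/
lemma integral_norm_sum_sq_pi (n : ℕ) {g : E → EuclideanSpace ℝ (Fin d)} {B : ℝ}
    (hg : Measurable g) (hB : ∀ y, ‖g y‖ ≤ B) (h0 : ∫ y, g y ∂ν = 0) :
    ∫ z, ‖∑ i : Fin n, g (z i)‖ ^ 2 ∂(Measure.pi fun _ => ν) = n * ∫ y, ‖g y‖ ^ 2 ∂ν := by
  have hgi : Integrable g ν := Integrable.of_bound (C := B) hg.aestronglyMeasurable (.of_forall hB)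
  have hLp : ∀ j, MemLp (fun y => g y j) 2 ν := fun j =>
    MemLp.of_bound (by fun_prop) B
      (.of_forall fun y => (PiLp.norm_apply_le (g y) j).trans (hB y))
  have h0j : ∀ j, ∫ y, g y j ∂ν = 0 := fun j => by
    have := (EuclideanSpace.proj (𝕜 := ℝ) j : EuclideanSpace ℝ (Fin d) →L[ℝ] ℝ).integral_comp_comm hgi
    rw [h0] at this
    simpa using this
  simp only [EuclideanSpace.real_norm_sq_eq, WithLp.ofLp_sum, Finset.sum_apply]
  rw [integral_finsetSum _ fun j _ => ?_, integral_finsetSum _ fun j _ => (hLp j).integrable_sq,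
    Finset.mul_sum]
  · exact Finset.sum_congr rfl fun j _ => integral_sum_sq_pi ν n (hLp j) (h0j j)
  · refine MemLp.integrable_sq (memLp_finsetSum _ fun i _ => ?_)
    exact (hLp j).comp_measurePreserving (measurePreserving_eval (fun _ : Fin n => ν) i)

end SecondMoment

/-! ### Estimator and score in unnormalised form, with deterministic bounds -/

section Estimator

variable {d n : ℕ}

/-- The unnormalised kernel density estimator. -/
def weightSum (t : ℝ) (z : Fin n → EuclideanSpace ℝ (Fin d)) (x : EuclideanSpace ℝ (Fin d)) : ℝ :=
  ∑ i, gaussWeight t (x - z i)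

/-- The unnormalised gradient of the kernel density estimator. -/
def momentSum (t : ℝ) (z : Fin n → EuclideanSpace ℝ (Fin d)) (x : EuclideanSpace ℝ (Fin d)) :
    EuclideanSpace ℝ (Fin d) :=
  ∑ i, gaussWeight t (x - z i) • (z i - x)

/-- The normalising constant of the heat kernel. -/
def heatConst (d : ℕ) (t : ℝ) : ℝ := 1 / (2 * Real.pi * t) ^ ((d : ℝ) / 2)

lemma heatConst_pos (d : ℕ) {t : ℝ} (ht : 0 < t) : 0 < heatConst d t := by
  unfold heatConst
  positivity

lemma heatKernel_eq (t : ℝ) (x : EuclideanSpace ℝ (Fin d)) :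
    heatKernel d t x = heatConst d t * gaussWeight t x := rfl

/-- The factor `heatConst d t / n` is common to estimator, gradient and threshold and cancels,
leaving a cutoff that depends on n alone. -/
lemma scoreEstimator_eq {t : ℝ} (ht : 0 < t) (hn : 2 ≤ n) (z : Fin n → EuclideanSpace ℝ (Fin d))
    (x : EuclideanSpace ℝ (Fin d)) :
    scoreEstimator d n t z x =
      if Real.log n ≤ weightSum t z x then (t * weightSum t z x)⁻¹ • momentSum t z x else 0 := by
  have hN := heatConst_pos d ht
  have hn0 : (0 : ℝ) < n := by positivity
  have hk : kde d n t z x = heatConst d t / n * weightSum t z x := by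
    simp only [kde, heatKernel_eq, weightSum, ← Finset.mul_sum]
    ring
  have hg : gradKde d n t z x = (heatConst d t / n * t⁻¹) • momentSum t z x := by
    simp only [gradKde, heatKernel_eq, momentSum, mul_smul, ← Finset.smul_sum]
    simp only [smul_smul]
    congr 1
    field_simp
  have hth : threshold d n t = heatConst d t / n * Real.log n := by
    rw [threshold, heatConst]
    field_simp
  have hpos : 0 < heatConst d t / n := by positivity
  rw [scoreEstimator, hk, hg, hth]
  simp only [mul_le_mul_iff_right₀ hpos]
  congr 1
  rw [smul_smul]
  congr 1
  field_simp

variable {t : ℝ} (ht : 0 < t)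
include ht

/-- Weighted Cauchy–Schwarz, then the entropy inequality at c = 1/n for each sample point; the n
copies of c add up to the final 1. -/
lemma norm_momentSum_sq_le (hn : 2 ≤ n) (z : Fin n → EuclideanSpace ℝ (Fin d))
    (x : EuclideanSpace ℝ (Fin d)) :
    ‖momentSum t z x‖ ^ 2 ≤
      weightSum t z x * (2 * t * (weightSum t z x * Real.log n + 1)) := by
  have hn0 : (0 : ℝ) < n := by positivity
  have hW : 0 ≤ weightSum t z x := Finset.sum_nonneg fun i _ => (gaussWeight_pos _ _).le
  have h1 : ‖momentSum t z x‖ ≤ ∑ i, gaussWeight t (x - z i) * ‖x - z i‖ := by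
    refine (norm_sum_le _ _).trans (Finset.sum_le_sum fun i _ => ?_)
    rw [norm_smul, Real.norm_of_nonneg (gaussWeight_pos _ _).le, norm_sub_rev]
  have h2 : (∑ i, gaussWeight t (x - z i) * ‖x - z i‖) ^ 2 ≤
      weightSum t z x * ∑ i, gaussWeight t (x - z i) * ‖x - z i‖ ^ 2 :=
    Finset.sum_sq_le_sum_mul_sum_of_sq_le_mul _ (fun i _ => (gaussWeight_pos _ _).le)
      (fun i _ => mul_nonneg (gaussWeight_pos _ _).le (sq_nonneg _)) fun i _ => le_of_eq (by ring)
  have h3 : ∑ i, gaussWeight t (x - z i) * ‖x - z i‖ ^ 2 ≤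
      2 * t * (weightSum t z x * Real.log n + 1) := by
    have : ∀ i ∈ Finset.univ, gaussWeight t (x - z i) * ‖x - z i‖ ^ 2 ≤
        2 * t * (gaussWeight t (x - z i) * Real.log n + (n : ℝ)⁻¹) := fun i _ => by
      refine (gaussWeight_mul_norm_sq_le ht (inv_pos.2 hn0) _).trans ?_
      rw [Real.log_inv, neg_neg]
      have := gaussWeight_pos t (x - z i)
      gcongr
      linarith
    refine (Finset.sum_le_sum this).trans_eq ?_
    rw [← Finset.mul_sum, Finset.sum_add_distrib, ← Finset.sum_mul]
    simp [weightSum, hn0.ne']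
  calc _ ≤ _ := pow_le_pow_left₀ (norm_nonneg _) h1 2
    _ ≤ _ := h2
    _ ≤ _ := mul_le_mul_of_nonneg_left h3 hW

omit ht in
lemma one_half_lt_log {n : ℕ} (hn : 2 ≤ n) : (1 / 2 : ℝ) < Real.log n := by
  have h1 : Real.log 2 ≤ Real.log n := Real.log_le_log two_pos (by exact_mod_cast hn)
  linarith [Real.log_two_gt_d9]

/-- The cutoff pays for the additive 1 in `norm_momentSum_sq_le`: where the estimator is nonzero, W
≥ log n > 1/2, so 1 ≤ 2W. -/
lemma norm_scoreEstimator_sq_le (hn : 2 ≤ n) (z : Fin n → EuclideanSpace ℝ (Fin d))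
    (x : EuclideanSpace ℝ (Fin d)) :
    ‖scoreEstimator d n t z x‖ ^ 2 ≤ 2 / t * (Real.log n + 2) := by
  have hl := one_half_lt_log hn
  rw [scoreEstimator_eq ht hn]
  split_ifs with h
  · set W := weightSum t z x
    have hW : 0 < W := by linarith
    have h1 := norm_momentSum_sq_le ht hn z x
    rw [norm_smul, mul_pow, norm_inv, Real.norm_of_nonneg (by positivity), inv_pow,
      inv_mul_le_iff₀ (by positivity)]
    refine h1.trans ?_
    have : (t * W) ^ 2 * (2 / t * (Real.log n + 2)) = W * (2 * t * (W * Real.log n + 2 * W)) := by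
      field_simp
    rw [this]
    gcongr
    linarith
  · rw [norm_zero, zero_pow two_ne_zero]
    positivity

variable (ν : Measure (EuclideanSpace ℝ (Fin d))) [IsProbabilityMeasure ν]

/-- The score of the Gaussian convolution of `ν`. -/
def smoothedScore (ν : Measure (EuclideanSpace ℝ (Fin d))) (t : ℝ) (x : EuclideanSpace ℝ (Fin d)) :
    EuclideanSpace ℝ (Fin d) :=
  (t * gaussMass ν t x)⁻¹ • gaussMoment ν t x

/-- The parameter c stays free because it may depend on x: c = u suits the bulk, a decaying c the
tails. -/
lemma norm_smoothedScore_sq_mul_le (x : EuclideanSpace ℝ (Fin d)) {c : ℝ} (hc : 0 < c) :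
    ‖smoothedScore ν t x‖ ^ 2 * gaussMass ν t x ≤
      2 / t * (gaussMass ν t x * (-Real.log c) + c - gaussMass ν t x) := by
  have h1 := norm_gaussMoment_sq_le ν ht x
  have h2 := integral_gaussWeight_mul_norm_sq_le ν ht x hc
  have hu := gaussMass_pos ν ht x
  set u := gaussMass ν t x
  rw [smoothedScore, norm_smul, mul_pow, norm_inv, Real.norm_of_nonneg (by positivity)]
  calc _ = (t ^ 2 * u)⁻¹ * ‖gaussMoment ν t x‖ ^ 2 := by
        change ((t * u)⁻¹ ^ 2 * _) * u = _
        field_simp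
    _ ≤ (t ^ 2 * u)⁻¹ * (u * (2 * t * (u * (-Real.log c) + c - u))) := by gcongr; exact h1.trans (by gcongr)
    _ = _ := by field_simp

/-- Error bound where the smoothed density is small. -/
lemma norm_sub_sq_mul_le_of_entropy (hn : 2 ≤ n) (z : Fin n → EuclideanSpace ℝ (Fin d))
    (x : EuclideanSpace ℝ (Fin d)) {c : ℝ} (hc : 0 < c) :
    ‖scoreEstimator d n t z x - smoothedScore ν t x‖ ^ 2 * gaussMass ν t x ≤
      4 / t * ((Real.log n + 2) * gaussMass ν t x + gaussMass ν t x * (-Real.log c) + c) := by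
  have hu := gaussMass_pos ν ht x
  have h1 := norm_scoreEstimator_sq_le ht hn z x
  have h2 := norm_smoothedScore_sq_mul_le ht ν x hc
  set a := scoreEstimator d n t z x
  set s := smoothedScore ν t x
  set u := gaussMass ν t x
  have h3 : ‖a - s‖ ^ 2 ≤ 2 * ‖a‖ ^ 2 + 2 * ‖s‖ ^ 2 := by
    have := norm_sub_le a s
    have h4 := norm_nonneg (a - s)
    nlinarith [sq_nonneg (‖a‖ - ‖s‖)]
  have h5 : 0 ≤ 2 / t * u := by positivity
  calc _ ≤ (2 * ‖a‖ ^ 2 + 2 * ‖s‖ ^ 2) * u := by gcongr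
    _ = 2 * (‖a‖ ^ 2 * u) + 2 * (‖s‖ ^ 2 * u) := by ring
    _ ≤ 2 * (2 / t * (Real.log n + 2) * u) + 2 * (2 / t * (u * (-Real.log c) + c - u)) := by gcongr
    _ = 4 / t * ((Real.log n + 2) * u + u * (-Real.log c) + c) - 2 * (2 / t * u) := by ring
    _ ≤ _ := by linarith

/-! ### Stochastic error where the density is large -/

/-- The summands of the centred estimator. -/
def centredMoment (ν : Measure (EuclideanSpace ℝ (Fin d))) (t : ℝ)
    (x y : EuclideanSpace ℝ (Fin d)) : EuclideanSpace ℝ (Fin d) :=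
  gaussWeight t (x - y) • (y - x - (gaussMass ν t x)⁻¹ • gaussMoment ν t x)

-- Recentring at the tilted mean linearises the quotient: divided by tW, the right side is the
-- untruncated estimator minus the score.
omit ht [IsProbabilityMeasure ν] in
lemma sum_centredMoment (z : Fin n → EuclideanSpace ℝ (Fin d)) (x : EuclideanSpace ℝ (Fin d)) :
    ∑ i, centredMoment ν t x (z i) =
      momentSum t z x - (weightSum t z x * (gaussMass ν t x)⁻¹) • gaussMoment ν t x := by
  simp only [centredMoment, smul_sub _ (_ - _), Finset.sum_sub_distrib, ← Finset.sum_smul, mul_smul,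
    momentSum, weightSum]

omit ht [IsProbabilityMeasure ν] in
lemma centredMoment_eq (x y : EuclideanSpace ℝ (Fin d)) :
    centredMoment ν t x y = gaussWeight t (x - y) • (y - x) -
      gaussWeight t (x - y) • ((gaussMass ν t x)⁻¹ • gaussMoment ν t x) := smul_sub _ _ _

lemma integral_centredMoment (x : EuclideanSpace ℝ (Fin d)) :
    ∫ y, centredMoment ν t x y ∂ν = 0 := by
  simp_rw [centredMoment_eq]
  rw [integral_sub (integrable_gaussWeight_smul ν ht x)
    ((integrable_gaussWeight ν ht x).smul_const _), integral_smul_const]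
  change gaussMoment ν t x - gaussMass ν t x • _ = 0
  rw [smul_smul, mul_inv_cancel₀ (gaussMass_pos ν ht x).ne', one_smul, sub_self]

omit [IsProbabilityMeasure ν] in
lemma norm_centredMoment_le (x y : EuclideanSpace ℝ (Fin d)) :
    ‖centredMoment ν t x y‖ ≤
      1 + 2 * t + ‖(gaussMass ν t x)⁻¹ • gaussMoment ν t x‖ := by
  rw [centredMoment_eq]
  refine (norm_sub_le _ _).trans (add_le_add (norm_gaussWeight_smul_le ht x y) ?_)
  rw [norm_smul, Real.norm_of_nonneg (gaussWeight_pos _ _).le]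
  exact mul_le_of_le_one_left (norm_nonneg _) (gaussWeight_le_one ht _)

omit ht [IsProbabilityMeasure ν] in
lemma measurable_centredMoment (x : EuclideanSpace ℝ (Fin d)) :
    Measurable (centredMoment ν t x) := by
  unfold centredMoment
  exact Continuous.measurable (by fun_prop)

/-- One factor of the weight is dropped (w² ≤ w), leaving the tilted variance; it is at most the
second moment, and the entropy bound at c = u cancels c - u. -/
lemma integral_norm_centredMoment_sq_le (x : EuclideanSpace ℝ (Fin d)) :
    ∫ y, ‖centredMoment ν t x y‖ ^ 2 ∂ν ≤
      2 * t * (gaussMass ν t x * (-Real.log (gaussMass ν t x))) := by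
  have hu := gaussMass_pos ν ht x
  have h1 := integral_gaussWeight_mul_norm_sq_le ν ht x hu
  have h2 := integral_gaussWeight_mul_norm_sub_sq ν ht x
  have h3 : ∫ y, ‖centredMoment ν t x y‖ ^ 2 ∂ν ≤ ∫ y, gaussWeight t (x - y) *
        ‖y - x - (gaussMass ν t x)⁻¹ • gaussMoment ν t x‖ ^ 2 ∂ν := by
    refine integral_mono_of_nonneg (.of_forall fun y => sq_nonneg _) ?_ (.of_forall fun y => ?_)
    · refine Integrable.of_bound
        (C := (1 + 2 * t + ‖(gaussMass ν t x)⁻¹ • gaussMoment ν t x‖) *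
          (1 + 2 * t + ‖(gaussMass ν t x)⁻¹ • gaussMoment ν t x‖) +
          ‖(gaussMass ν t x)⁻¹ • gaussMoment ν t x‖ ^ 2 + 2 * t * 2)
        (by fun_prop) (.of_forall fun y => ?_)
      have ha := norm_sub_le (y - x) ((gaussMass ν t x)⁻¹ • gaussMoment ν t x)
      have hb := gaussWeight_mul_norm_sq_le' ht (x - y)
      have hc := gaussWeight_le_one ht (x - y)
      have hd := gaussWeight_pos t (x - y)
      rw [norm_sub_rev x y] at hb
      rw [Real.norm_of_nonneg (mul_nonneg hd.le (sq_nonneg _))]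
      set m := ‖(gaussMass ν t x)⁻¹ • gaussMoment ν t x‖
      set k := ‖y - x‖
      have hm : 0 ≤ m := norm_nonneg _
      have he : ‖y - x - (gaussMass ν t x)⁻¹ • gaussMoment ν t x‖ ^ 2 ≤ 2 * k ^ 2 + 2 * m ^ 2 := by
        refine (pow_le_pow_left₀ (norm_nonneg _) ha 2).trans ?_
        nlinarith [sq_nonneg (k - m)]
      refine (mul_le_mul_of_nonneg_left he hd.le).trans ?_
      have hf : gaussWeight t (x - y) * m ^ 2 ≤ m ^ 2 :=
        mul_le_of_le_one_left (sq_nonneg _) hc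
      nlinarith [mul_nonneg ht.le hm]
    · simp only [centredMoment, norm_smul, mul_pow, Real.norm_of_nonneg (gaussWeight_pos t _).le]
      gcongr
      nlinarith [gaussWeight_pos t (x - y), gaussWeight_le_one ht (x - y)]
  have h4 : 0 ≤ (gaussMass ν t x)⁻¹ * ‖gaussMoment ν t x‖ ^ 2 := by positivity
  linarith

/-- Error bound where the smoothed density exceeds the threshold, before taking expectations. -/
lemma norm_sub_sq_le_of_le_gaussMass (hn : 2 ≤ n) (z : Fin n → EuclideanSpace ℝ (Fin d))
    (x : EuclideanSpace ℝ (Fin d)) (hx : 2 * Real.log n ≤ n * gaussMass ν t x) :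
    ‖scoreEstimator d n t z x - smoothedScore ν t x‖ ^ 2 ≤
      4 / (t * (n * gaussMass ν t x)) ^ 2 * ‖∑ i, centredMoment ν t x (z i)‖ ^ 2 +
      16 / t * (2 * Real.log n + 3) / (n * gaussMass ν t x) ^ 2 *
        (∑ i, (gaussWeight t (x - z i) - gaussMass ν t x)) ^ 2 := by
  have hl := one_half_lt_log hn
  have hn0 : (0 : ℝ) < n := by positivity
  have hu := gaussMass_pos ν ht x
  have hsum : ∑ i, (gaussWeight t (x - z i) - gaussMass ν t x) =
      weightSum t z x - n * gaussMass ν t x := by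
    simp [weightSum, Finset.sum_sub_distrib]
  rw [hsum]
  set u := gaussMass ν t x with hu_def
  set W := weightSum t z x with hW_def
  have hnu : 0 < n * u := by positivity
  by_cases hW : n * u / 2 ≤ W
  · have hWpos : 0 < W := by linarith
    have heq : scoreEstimator d n t z x - smoothedScore ν t x =
        (t * W)⁻¹ • ∑ i, centredMoment ν t x (z i) := by
      -- The cutoff is passed because W ≥ nu/2 ≥ log n.
      rw [scoreEstimator_eq ht hn, if_pos (by linarith), smoothedScore, sum_centredMoment,
        smul_sub, smul_smul]
      congr 2
      change (t * u)⁻¹ = (t * W)⁻¹ * (W * u⁻¹)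
      field_simp
    rw [heq, norm_smul, mul_pow, norm_inv, Real.norm_of_nonneg (by positivity)]
    have h1 : (t * W)⁻¹ ^ 2 ≤ 4 / (t * (n * u)) ^ 2 := by
      calc (t * W)⁻¹ ^ 2 ≤ (t * (n * u / 2))⁻¹ ^ 2 := by gcongr
        _ = _ := by
          field_simp
          norm_num
    have h2 : 0 ≤ 16 / t * (2 * Real.log n + 3) / (n * u) ^ 2 * (W - n * u) ^ 2 := by positivity
    have h3 := mul_le_mul_of_nonneg_right h1
      (sq_nonneg ‖∑ i, centredMoment ν t x (z i)‖)
    linarith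
  · push Not at hW
    have h1 := norm_sub_sq_mul_le_of_entropy ht ν hn z x hu
    have h2 : -Real.log u ≤ Real.log n := by
      have : Real.log (n * u) ≥ 0 := Real.log_nonneg (by linarith)
      rw [Real.log_mul hn0.ne' hu.ne'] at this
      linarith
    have h3 : ‖scoreEstimator d n t z x - smoothedScore ν t x‖ ^ 2 ≤
        4 / t * (2 * Real.log n + 3) := by
      refine le_of_mul_le_mul_right (h1.trans ?_) hu
      rw [mul_assoc (4 / t) (2 * Real.log n + 3) u]
      refine mul_le_mul_of_nonneg_left ?_ (by positivity)
      nlinarith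
    -- Chebyshev before expectations: the deviation exceeds nu/2, so the crude bound `h3` may be
    -- multiplied by this ratio.
    have h4 : 1 ≤ 4 * (W - n * u) ^ 2 / (n * u) ^ 2 := by
      rw [one_le_div (by positivity)]
      nlinarith
    have h5 : 0 ≤ 4 / (t * (n * u)) ^ 2 * ‖∑ i, centredMoment ν t x (z i)‖ ^ 2 := by positivity
    have h6 : 4 / t * (2 * Real.log n + 3) ≤
        4 / t * (2 * Real.log n + 3) * (4 * (W - n * u) ^ 2 / (n * u) ^ 2) :=
      le_mul_of_one_le_right (by positivity) h4
    have h7 : 4 / t * (2 * Real.log n + 3) * (4 * (W - n * u) ^ 2 / (n * u) ^ 2) =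
      16 / t * (2 * Real.log n + 3) / (n * u) ^ 2 * (W - n * u) ^ 2 := by ring
    linarith

/-- Expected error where the smoothed density exceeds the threshold. -/
lemma lintegral_norm_sub_sq_mul_le_of_le_gaussMass (hn : 2 ≤ n) (x : EuclideanSpace ℝ (Fin d))
    (hx : 2 * Real.log n ≤ n * gaussMass ν t x) :
    ∫⁻ z, ENNReal.ofReal
        (‖scoreEstimator d n t z x - smoothedScore ν t x‖ ^ 2 * gaussMass ν t x)
        ∂(Measure.pi fun _ => ν) ≤
      ENNReal.ofReal (152 * Real.log n / (t * n)) := by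
  have hl := one_half_lt_log hn
  have hn0 : (0 : ℝ) < n := by positivity
  have hu := gaussMass_pos ν ht x
  have hw := integrable_gaussWeight ν ht x
  have hwm : MemLp (fun y => gaussWeight t (x - y) - gaussMass ν t x) 2 ν := by
    refine MemLp.of_bound (by fun_prop) 1 (.of_forall fun y => ?_)
    have := gaussMass_le_one ν ht x
    have := gaussWeight_le_one ht (x - y)
    have := gaussWeight_pos t (x - y)
    rw [Real.norm_eq_abs, abs_le]
    constructor <;> linarith
  have hw0 : ∫ y, (gaussWeight t (x - y) - gaussMass ν t x) ∂ν = 0 := by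
    rw [integral_sub hw (integrable_const _)]
    simp [gaussMass]
  have hvar : ∫ y, (gaussWeight t (x - y) - gaussMass ν t x) ^ 2 ∂ν ≤ gaussMass ν t x := by
    have hle : ∀ y, (gaussWeight t (x - y) - gaussMass ν t x) ^ 2 ≤
        gaussWeight t (x - y) + gaussMass ν t x ^ 2 - 2 * gaussMass ν t x * gaussWeight t (x - y) :=
      fun y => by
        nlinarith [gaussWeight_pos t (x - y), gaussWeight_le_one ht (x - y)]
    have := integral_mono hwm.integrable_sq
      ((hw.add (integrable_const (gaussMass ν t x ^ 2))).sub
        (hw.const_mul (2 * gaussMass ν t x))) hle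
    simp only [Pi.sub_apply, Pi.add_apply] at this
    rw [integral_sub (by fun_prop) (by fun_prop), integral_add hw (by fun_prop),
      integral_const_mul] at this
    simp only [integral_const, probReal_univ, smul_eq_mul, one_mul] at this
    change _ ≤ gaussMass ν t x + gaussMass ν t x ^ 2 - 2 * gaussMass ν t x * gaussMass ν t x at this
    nlinarith
  have hlog : -Real.log (gaussMass ν t x) ≤ Real.log n := by
    have : Real.log (n * gaussMass ν t x) ≥ 0 := Real.log_nonneg (by linarith)
    rw [Real.log_mul hn0.ne' hu.ne'] at this
    linarith
  have hcm := measurable_centredMoment (t := t) ν x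
  have hcb := norm_centredMoment_le ht ν x
  have hA := integral_norm_sum_sq_pi ν n hcm hcb (integral_centredMoment ht ν x)
  have hB := integral_sum_sq_pi ν n hwm hw0
  have hAi : Integrable (fun z : Fin n → EuclideanSpace ℝ (Fin d) =>
      ‖∑ i, centredMoment ν t x (z i)‖ ^ 2) (Measure.pi fun _ => ν) := by
    refine Integrable.of_bound (C := (∑ _i : Fin n,
      (1 + 2 * t + ‖(gaussMass ν t x)⁻¹ • gaussMoment ν t x‖)) ^ 2) ?_ (.of_forall fun z => ?_)
    · refine Measurable.aestronglyMeasurable ?_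
      fun_prop
    · rw [Real.norm_of_nonneg (sq_nonneg _)]
      gcongr
      exact norm_sum_le_of_le _ fun i _ => hcb _
  have hBi : Integrable (fun z : Fin n → EuclideanSpace ℝ (Fin d) =>
      (∑ i, (gaussWeight t (x - z i) - gaussMass ν t x)) ^ 2) (Measure.pi fun _ => ν) := by
    refine MemLp.integrable_sq (memLp_finsetSum _ fun i _ => ?_)
    exact hwm.comp_measurePreserving (measurePreserving_eval (fun _ : Fin n => ν) i)
  have hint := ((hAi.const_mul (4 / (t * (n * gaussMass ν t x)) ^ 2)).add
    (hBi.const_mul (16 / t * (2 * Real.log n + 3) / (n * gaussMass ν t x) ^ 2))).mul_const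
    (gaussMass ν t x)
  simp only [Pi.add_apply] at hint
  refine (lintegral_mono fun z => ENNReal.ofReal_le_ofReal (mul_le_mul_of_nonneg_right
    (norm_sub_sq_le_of_le_gaussMass ht ν hn z x hx) hu.le)).trans ?_
  rw [← ofReal_integral_eq_lintegral_ofReal hint (.of_forall fun z => by
    simp only [Pi.zero_apply]
    positivity)]
  refine ENNReal.ofReal_le_ofReal ?_
  rw [integral_mul_const, integral_add (by fun_prop) (by fun_prop), integral_const_mul,
    integral_const_mul, hA, hB]
  have hcov := integral_norm_centredMoment_sq_le ht ν x
  set u := gaussMass ν t x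
  have hcov' : ∫ y, ‖centredMoment ν t x y‖ ^ 2 ∂ν ≤ 2 * t * (u * Real.log n) :=
    hcov.trans (by gcongr)
  calc _ ≤ (4 / (t * (n * u)) ^ 2 * (n * (2 * t * (u * Real.log n))) +
        16 / t * (2 * Real.log n + 3) / (n * u) ^ 2 * (n * u)) * u := by gcongr
    _ = (40 * Real.log n + 48) / (t * n) := by
      field_simp
      ring
    -- log n > 1/2 absorbs the additive 48 into the multiple of log n.
    _ ≤ _ := by
      gcongr
      linarith

end Estimator

/-! ### Mass and moments of the heat kernel -/

section HeatKernel

variable {d : ℕ} {t : ℝ}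

lemma heatKernel_nonneg (ht : 0 < t) (x : EuclideanSpace ℝ (Fin d)) : 0 ≤ heatKernel d t x :=
  mul_nonneg (heatConst_pos d ht).le (gaussWeight_pos t x).le

lemma integral_heatKernel (ht : 0 < t) : ∫ y, heatKernel d t y = 1 := by
  have h := GaussianFourier.integral_rexp_neg_mul_sq_norm (V := EuclideanSpace ℝ (Fin d))
    (b := (2 * t)⁻¹) (by positivity)
  simp only [heatKernel]
  rw [integral_const_mul]
  have h1 : ∀ v : EuclideanSpace ℝ (Fin d), -‖v‖ ^ 2 / (2 * t) = -(2 * t)⁻¹ * ‖v‖ ^ 2 := fun v => by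
    field_simp
  simp_rw [h1]
  rw [h, finrank_euclideanSpace_fin]
  have h2 : Real.pi / (2 * t)⁻¹ = 2 * Real.pi * t := by field_simp
  rw [h2]
  have : 0 < (2 * Real.pi * t) ^ ((d : ℝ) / 2) := by positivity
  field_simp

lemma integrable_heatKernel (ht : 0 < t) : Integrable (heatKernel d t) :=
  Integrable.of_integral_ne_zero (by rw [integral_heatKernel ht]; exact one_ne_zero)

lemma rpow_le_rpow_self_mul_exp {s a : ℝ} (hs : 0 < s) (ha : 0 ≤ a) :
    a ^ s ≤ s ^ s * Real.exp a := by
  have h1 : a ≤ s * Real.exp (a / s) := by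
    have := Real.add_one_le_exp (a / s)
    calc a = s * (a / s) := by field_simp
      _ ≤ _ := by gcongr; linarith
  calc a ^ s ≤ (s * Real.exp (a / s)) ^ s := by gcongr
    _ = _ := by
      rw [Real.mul_rpow hs.le (Real.exp_pos _).le, ← Real.exp_mul, div_mul_cancel₀ _ hs.ne']

/-- In the variable ‖z‖²/(2t) the exponential beats the power, and the powers of t combine to
t^(-d/2) t^((1+γ+d)/2) = t^((1+γ)/2). -/
lemma heatKernel_mul_rpow_le {γ : ℝ} (hγ : 0 < γ) (ht : 0 < t) (z : EuclideanSpace ℝ (Fin d)) :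
    heatKernel d t z * ‖z‖ ^ (1 + γ + d) ≤
      2 ^ ((1 + γ + d) / 2) * ((1 + γ + d) / 2) ^ ((1 + γ + d) / 2) *
        max 1 t ^ ((1 + γ) / 2) := by
  set s := (1 + γ + d) / 2 with hs_def
  have hs : 0 < s := by positivity
  have hz : ‖z‖ ^ (1 + γ + d) = (2 * t) ^ s * (‖z‖ ^ 2 / (2 * t)) ^ s := by
    rw [← Real.mul_rpow (by positivity) (by positivity), mul_div_cancel₀ _ (by positivity),
      ← Real.rpow_natCast, ← Real.rpow_mul (norm_nonneg _)]
    congr 1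
    push_cast
    ring
  have hexp : Real.exp (-‖z‖ ^ 2 / (2 * t)) * (‖z‖ ^ 2 / (2 * t)) ^ s ≤ s ^ s := by
    have := rpow_le_rpow_self_mul_exp hs (a := ‖z‖ ^ 2 / (2 * t)) (by positivity)
    rw [neg_div, Real.exp_neg, inv_mul_le_iff₀ (Real.exp_pos _)]
    linarith
  have hconst : 1 / (2 * Real.pi * t) ^ ((d : ℝ) / 2) * (2 * t) ^ s ≤
      2 ^ s * max 1 t ^ ((1 + γ) / 2) := by
    have h1 : t ^ ((d : ℝ) / 2) ≤ (2 * Real.pi * t) ^ ((d : ℝ) / 2) := by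
      gcongr
      nlinarith [Real.pi_gt_three]
    have h2 : t ^ s = t ^ ((1 + γ) / 2) * t ^ ((d : ℝ) / 2) := by
      rw [← Real.rpow_add ht]
      congr 1
      rw [hs_def]
      ring
    rw [Real.mul_rpow two_pos.le ht.le, one_div_mul_eq_div, div_le_iff₀ (by positivity), h2]
    calc (2 : ℝ) ^ s * (t ^ ((1 + γ) / 2) * t ^ ((d : ℝ) / 2)) =
        2 ^ s * t ^ ((1 + γ) / 2) * t ^ ((d : ℝ) / 2) := by ring
      _ ≤ _ := by
        gcongr
        exact le_max_right _ _
  calc heatKernel d t z * ‖z‖ ^ (1 + γ + d) =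
      (1 / (2 * Real.pi * t) ^ ((d : ℝ) / 2) * (2 * t) ^ s) *
        (Real.exp (-‖z‖ ^ 2 / (2 * t)) * (‖z‖ ^ 2 / (2 * t)) ^ s) := by
        rw [hz, heatKernel]
        ring
    _ ≤ (2 ^ s * max 1 t ^ ((1 + γ) / 2)) * s ^ s := by gcongr
    _ = _ := by ring

end HeatKernel

/-! ### The diffused density: its score and its tail -/

section Density

variable {d : ℕ} {β L : ℝ} {p₀ : EuclideanSpace ℝ (Fin d) → ℝ}

lemma SobolevDensity.isProbabilityMeasure (hp : SobolevDensity d β L p₀) :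
    IsProbabilityMeasure (densityMeasure d p₀) := by
  refine ⟨?_⟩
  rw [densityMeasure, withDensity_apply _ MeasurableSet.univ, Measure.restrict_univ,
    ← ofReal_integral_eq_lintegral_ofReal hp.integrable hp.nonneg, hp.integral_eq_one,
    ENNReal.ofReal_one]

lemma SobolevDensity.diffusedDensity_eq (hp : SobolevDensity d β L p₀) (t : ℝ)
    (x : EuclideanSpace ℝ (Fin d)) :
    diffusedDensity d p₀ t x = heatConst d t * gaussMass (densityMeasure d p₀) t x := by
  rw [gaussMass, densityMeasure, integral_withDensity_eq_integral_toReal_smul₀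
    hp.integrable.aemeasurable.ennreal_ofReal (.of_forall fun _ => ENNReal.ofReal_lt_top),
    ← integral_const_mul, diffusedDensity]
  refine integral_congr_ae ?_
  filter_upwards [hp.nonneg] with y hy
  rw [ENNReal.toReal_ofReal hy, heatKernel_eq, smul_eq_mul]
  ring

lemma SobolevDensity.score_eq (hp : SobolevDensity d β L p₀) {t : ℝ} (ht : 0 < t)
    (x : EuclideanSpace ℝ (Fin d)) :
    score d p₀ t x = smoothedScore (densityMeasure d p₀) t x := by
  have := hp.isProbabilityMeasure
  have hN := heatConst_pos d ht
  have hu := gaussMass_pos (densityMeasure d p₀) ht x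
  have h := (hasGradientAt_gaussMass (densityMeasure d p₀) ht x).hasFDerivAt
  have h2 := (h.const_mul (heatConst d t)).log (by positivity)
  simp_rw [← hp.diffusedDensity_eq] at h2
  refine HasGradientAt.gradient ?_
  rw [hasGradientAt_iff_hasFDerivAt]
  refine h2.congr_fderiv ?_
  rw [hp.diffusedDensity_eq, smoothedScore, ← map_smul, ← map_smul, smul_smul, smul_smul]
  congr 2
  field_simp

/-- If ‖x‖ ≤ 2‖y‖ the decay of the density at y absorbs ‖x‖^q; otherwise ‖x‖ ≤ 2‖x - y‖ and the
kernel does. The two terms on the right integrate in y to constants, since kernel and density both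
have mass one. -/
lemma tail_integrand_le {γ C₂ t b : ℝ} (hγ : 0 < γ) (hC₂ : 0 < C₂) (ht : 0 < t)
    (x y : EuclideanSpace ℝ (Fin d)) (h0 : 0 ≤ b)
    (hb : b ≤ C₂ / (1 + ‖y‖ ^ 2) ^ ((1 + γ + d) / 2)) :
    heatKernel d t (x - y) * b * ‖x‖ ^ (1 + γ + d) ≤
      C₂ * 2 ^ (1 + γ + d) * heatKernel d t (x - y) +
      2 ^ (1 + γ + d) * (2 ^ ((1 + γ + d) / 2) * ((1 + γ + d) / 2) ^ ((1 + γ + d) / 2) *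
        max 1 t ^ ((1 + γ) / 2)) * b := by
  have hk := heatKernel_nonneg ht (x - y)
  have hq : 0 < 1 + γ + d := by positivity
  have hm : 0 < max 1 t := lt_max_of_lt_left one_pos
  rcases le_total ‖x‖ (2 * ‖y‖) with h | h
  · have h1 : ‖x‖ ^ (1 + γ + d) ≤ 2 ^ (1 + γ + d) * (1 + ‖y‖ ^ 2) ^ ((1 + γ + d) / 2) := by
      calc ‖x‖ ^ (1 + γ + d) ≤ (2 * ‖y‖) ^ (1 + γ + d) := by gcongr
        _ = 2 ^ (1 + γ + d) * (‖y‖ ^ 2) ^ ((1 + γ + d) / 2) := by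
          rw [Real.mul_rpow two_pos.le (norm_nonneg _), ← Real.rpow_natCast ‖y‖ 2,
            ← Real.rpow_mul (norm_nonneg _)]
          congr 2
          push_cast
          ring
        _ ≤ _ := by
          gcongr
          linarith
    have h2 : b * ‖x‖ ^ (1 + γ + d) ≤ C₂ * 2 ^ (1 + γ + d) := by
      have hpos : 0 < (1 + ‖y‖ ^ 2) ^ ((1 + γ + d) / 2) := by positivity
      calc b * ‖x‖ ^ (1 + γ + d) ≤ C₂ / (1 + ‖y‖ ^ 2) ^ ((1 + γ + d) / 2) *
            (2 ^ (1 + γ + d) * (1 + ‖y‖ ^ 2) ^ ((1 + γ + d) / 2)) := by gcongr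
        _ = _ := by field_simp
    have h3 : 0 ≤ 2 ^ (1 + γ + d) * (2 ^ ((1 + γ + d) / 2) *
        ((1 + γ + d) / 2) ^ ((1 + γ + d) / 2) * max 1 t ^ ((1 + γ) / 2)) * b := by positivity
    nlinarith [mul_le_mul_of_nonneg_left h2 hk]
  · have h1 : ‖x‖ ≤ 2 * ‖x - y‖ := by
      have := norm_sub_norm_le x y
      linarith
    have h2 : heatKernel d t (x - y) * ‖x‖ ^ (1 + γ + d) ≤
        2 ^ (1 + γ + d) * (heatKernel d t (x - y) * ‖x - y‖ ^ (1 + γ + d)) := by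
      calc _ ≤ heatKernel d t (x - y) * (2 * ‖x - y‖) ^ (1 + γ + d) := by gcongr
        _ = _ := by
          rw [Real.mul_rpow two_pos.le (norm_nonneg _)]
          ring
    have h3 := heatKernel_mul_rpow_le hγ ht (x - y)
    have h4 : 0 ≤ C₂ * 2 ^ (1 + γ + d) * heatKernel d t (x - y) := by positivity
    have h5 := mul_le_mul_of_nonneg_right (h2.trans (mul_le_mul_of_nonneg_left h3
      (by positivity : (0 : ℝ) ≤ 2 ^ (1 + γ + d)))) h0
    linarith

/-- The Gaussian convolution inherits the polynomial tail, with constants uniform in time. -/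
lemma exists_diffusedDensity_tail (d : ℕ) {γ C₂ : ℝ} (hγ : 0 < γ) (hC₂ : 0 < C₂) :
    ∃ C₁ : ℝ, 0 < C₁ ∧ ∀ (β L : ℝ) (p₀ : EuclideanSpace ℝ (Fin d) → ℝ),
      PolynomialTail d γ C₂ p₀ → SobolevDensity d β L p₀ → ∀ t : ℝ, 0 < t → ∀ x,
        diffusedDensity d p₀ t x * ‖x‖ ^ (1 + γ + d) ≤ C₁ * max 1 t ^ ((1 + γ) / 2) := by
  refine ⟨C₂ * 2 ^ (1 + γ + d) + 2 ^ (1 + γ + d) * (2 ^ ((1 + γ + d) / 2) *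
    ((1 + γ + d) / 2) ^ ((1 + γ + d) / 2)), by positivity, fun β L p₀ htail hp t ht x => ?_⟩
  set q := 1 + γ + d
  set A := (2 : ℝ) ^ (q / 2) * (q / 2) ^ (q / 2)
  set M := max 1 t ^ ((1 + γ) / 2)
  have hM : 1 ≤ M := Real.one_le_rpow (le_max_left _ _) (by positivity)
  have hki : Integrable (fun y => heatKernel d t (x - y)) :=
    (integrable_heatKernel ht).comp_sub_left x
  have hk1 : ∫ y, heatKernel d t (x - y) = 1 := by
    rw [integral_sub_left_eq_self (heatKernel d t) volume x, integral_heatKernel ht]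
  have h : diffusedDensity d p₀ t x * ‖x‖ ^ q ≤
      ∫ y, (C₂ * 2 ^ q * heatKernel d t (x - y) + 2 ^ q * (A * M) * p₀ y) := by
    rw [diffusedDensity, ← integral_mul_const]
    refine integral_mono_of_nonneg ?_
      ((hki.const_mul _).add (hp.integrable.const_mul _)) ?_
    · filter_upwards [hp.nonneg] with y hy
      have := heatKernel_nonneg ht (x - y)
      simp only [Pi.zero_apply]
      positivity
    · filter_upwards [hp.nonneg, htail] with y hy hy'
      exact tail_integrand_le hγ hC₂ ht x y hy hy'
  rw [integral_add (hki.const_mul _) (hp.integrable.const_mul _), integral_const_mul,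
    integral_const_mul, hk1, hp.integral_eq_one] at h
  have h2 : C₂ * 2 ^ q ≤ C₂ * 2 ^ q * M := le_mul_of_one_le_right (by positivity) hM
  linarith

end Density

/-! ### Pointwise expected error with an integrable spatial profile -/

section Pointwise

/-- Bookkeeping for the low-density region, with y = ‖x‖/r, Y = (1+y)^(-q), Z = (1+y)^(-(q-1)), e
the squared error and a = -log c. The logarithm of the decaying c costs one factor 1 + y, which
turns Y into Z. The term 152 D is slack, so that both regions share one constant. -/
lemma entropy_error_arith {t N u ℓ ρ q D y Y Z e a c : ℝ} (ht : 0 < t) (hN : 0 < N) (hu : 0 < u)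
    (hl : 1 / 2 < ℓ) (hρ : 0 < ρ) (hq : 1 ≤ q) (hD : 0 < D) (hy : 0 ≤ y) (hZ : 0 < Z)
    (hYZ : Y ≤ Z) (hYZ' : (1 + y) * Y = Z)
    (he : e * u ≤ 4 / t * ((ℓ + 2) * u + u * a + c)) (ha : a ≤ ℓ + q * (1 + y))
    (hc : N * c ≤ 2 * ρ * Y) (hNu : N * u ≤ D * ρ * Y) :
    e * (N * u) ≤ (4 * ((6 + 2 * q) * D + 4) + 152 * D) / t * ℓ * ρ * Z := by
  have hq0 : 0 < q := by linarith
  have hl0 : 0 < ℓ := by linarith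
  calc _ = N * (e * u) := by ring
    _ ≤ N * (4 / t * ((ℓ + 2) * u + u * a + c)) := by gcongr
    _ ≤ N * (4 / t * ((ℓ + 2) * u + u * (ℓ + q * (1 + y)) + c)) := by gcongr
    _ = 4 / t * ((2 * ℓ + 2 + q * (1 + y)) * (N * u) + N * c) := by ring
    _ ≤ 4 / t * ((2 * ℓ + 2 + q * (1 + y)) * (D * ρ * Y) + 2 * ρ * Y) := by gcongr
    _ = 4 / t * ρ * (((2 * ℓ + 2) * D + 2) * Y + q * D * ((1 + y) * Y)) := by ring
    _ ≤ 4 / t * ρ * (((2 * ℓ + 2) * D + 2) * Z + q * D * Z) := by rw [hYZ']; gcongr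
    _ = 4 / t * ρ * Z * ((2 * ℓ + 2) * D + 2 + q * D) := by ring
    _ ≤ 4 / t * ρ * Z * (ℓ * ((6 + 2 * q) * D + 4)) := by
      gcongr
      have : 0 < q * D := by positivity
      nlinarith
    _ = (4 * ((6 + 2 * q) * D + 4)) / t * ℓ * ρ * Z := by ring
    _ ≤ _ := by
      gcongr
      linarith

variable {d n : ℕ} {t : ℝ} (ν : Measure (EuclideanSpace ℝ (Fin d))) [IsProbabilityMeasure ν]

/-- Expected weighted error at a point, given a polynomial tail on the length scale `r`. -/
lemma lintegral_norm_sub_sq_mul_le (ht : 0 < t) (hn : 2 ≤ n) {q C₁ r : ℝ} (hq : 1 ≤ q)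
    (hC₁ : 0 < C₁) (hr : 0 < r) (x : EuclideanSpace ℝ (Fin d))
    (htail : heatConst d t * gaussMass ν t x * ‖x‖ ^ q ≤ C₁ * threshold d n t * r ^ q) :
    ∫⁻ z, ENNReal.ofReal (‖scoreEstimator d n t z x - smoothedScore ν t x‖ ^ 2 *
        (heatConst d t * gaussMass ν t x)) ∂(Measure.pi fun _ => ν) ≤
      ENNReal.ofReal ((4 * ((6 + 2 * q) * (2 ^ q * (2 + C₁)) + 4) + 152 * (2 ^ q * (2 + C₁))) / t *
        Real.log n * threshold d n t * (1 + ‖x‖ / r) ^ (-(q - 1))) := by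
  have hl := one_half_lt_log hn
  have hn0 : (0 : ℝ) < n := by positivity
  have hu := gaussMass_pos ν ht x
  have hN := heatConst_pos d ht
  have hρ : threshold d n t = heatConst d t * Real.log n / n := by
    rw [threshold, heatConst]
    field_simp
  set u := gaussMass ν t x with hu_def
  set N := heatConst d t
  set ρ := threshold d n t
  set ℓ := Real.log n
  have hρ0 : 0 < ρ := by rw [hρ]; positivity
  set y := ‖x‖ / r with hy_def
  have hy : 0 ≤ y := by positivity
  set D := (2 : ℝ) ^ q * (2 + C₁) with hD
  have hD0 : 0 < D := by positivity
  set Z := (1 + y) ^ (-(q - 1)) with hZ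
  have hZ0 : 0 < Z := by positivity
  set Y := (1 + y) ^ (-q) with hY
  have hY0 : 0 < Y := by positivity
  have hYZ : (1 + y) * Y = Z := by
    have := Real.rpow_add (by positivity : 0 < 1 + y) 1 (-q)
    rw [Real.rpow_one] at this
    rw [hY, hZ, ← this]
    congr 1
    ring
  have hYZ' : Y ≤ Z := by nlinarith
  have hinv : (1 + y) ^ q * Y = 1 := by
    rw [hY, ← Real.rpow_add (by positivity), add_neg_cancel, Real.rpow_zero]
  have htail' : N * u * y ^ q ≤ C₁ * ρ := by
    rw [hy_def, Real.div_rpow (norm_nonneg _) hr.le, ← mul_div_assoc,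
      div_le_iff₀ (by positivity)]
    exact htail
  have h1y : (1 + y) ^ q ≤ 2 ^ q * (1 + y ^ q) := by
    rcases le_total y 1 with h | h
    · calc (1 + y) ^ q ≤ 2 ^ q := by gcongr; linarith
        _ ≤ _ := le_mul_of_one_le_right (by positivity) (by
          have : 0 ≤ y ^ q := by positivity
          linarith)
    · calc (1 + y) ^ q ≤ (2 * y) ^ q := by gcongr; linarith
        _ = 2 ^ q * y ^ q := Real.mul_rpow two_pos.le hy
        _ ≤ _ := by gcongr; linarith
  -- Used with a = 2ρ in the high region and a = N u in the low one. After (1+y)^q ≤ 2^q (1 + y^q),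
  -- the level bounds the first term and the tail the second.
  have hmin : ∀ a, 0 ≤ a → a ≤ N * u → a ≤ 2 * ρ → a ≤ D * ρ * Y := by
    intro a ha0 ha1 ha2
    have hyq : 0 ≤ y ^ q := by positivity
    have : a * (1 + y) ^ q ≤ D * ρ := by
      calc a * (1 + y) ^ q ≤ a * (2 ^ q * (1 + y ^ q)) := by gcongr
        _ = 2 ^ q * (a + a * y ^ q) := by ring
        _ ≤ 2 ^ q * (2 * ρ + N * u * y ^ q) := by gcongr
        _ ≤ 2 ^ q * (2 * ρ + C₁ * ρ) := by gcongr
        _ = _ := by ring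
    calc a = a * (1 + y) ^ q * Y := by rw [mul_assoc, hinv, mul_one]
      _ ≤ _ := by gcongr
  rcases le_total (2 * ℓ) (n * u) with hx | hx
  · have hhigh := lintegral_norm_sub_sq_mul_le_of_le_gaussMass ht ν hn x hx
    have hge : 2 * ρ ≤ N * u := by
      rw [hρ, ← mul_div_assoc, div_le_iff₀ hn0]
      nlinarith
    have h2 := hmin _ (by positivity) hge le_rfl
    have heq : ∀ z : Fin n → EuclideanSpace ℝ (Fin d),
        ENNReal.ofReal (‖scoreEstimator d n t z x - smoothedScore ν t x‖ ^ 2 * (N * u)) =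
        ENNReal.ofReal N *
          ENNReal.ofReal (‖scoreEstimator d n t z x - smoothedScore ν t x‖ ^ 2 * u) := fun z => by
      rw [← ENNReal.ofReal_mul hN.le]
      congr 1
      ring
    simp_rw [heq]
    rw [lintegral_const_mul' _ _ ENNReal.ofReal_ne_top]
    refine (mul_le_mul_right hhigh _).trans ?_
    rw [← ENNReal.ofReal_mul hN.le]
    refine ENNReal.ofReal_le_ofReal ?_
    calc N * (152 * ℓ / (t * n)) = 152 / t * ρ := by rw [hρ]; field_simp
      _ ≤ 152 / t * (ℓ * (D * ρ * Z)) := by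
        gcongr
        have : D * ρ * Y ≤ D * ρ * Z := by gcongr
        nlinarith
      _ = (152 * D) / t * ℓ * ρ * Z := by ring
      _ ≤ _ := by
        gcongr
        have : 0 ≤ 4 * ((6 + 2 * q) * D + 4) := by positivity
        linarith
  · have hle : N * u ≤ 2 * ρ := by
      rw [hρ, ← mul_div_assoc, le_div_iff₀ hn0]
      nlinarith
    have h2 := hmin _ (by positivity) le_rfl hle
    -- Entropy parameter c = Y/n: small enough to be integrable against the level ρ, while log(1/c)
    -- is only log n + q log(1 + y).
    have hc : 0 < Y / n := by positivity
    have hlogc : -Real.log (Y / n) ≤ ℓ + q * (1 + y) := by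
      rw [Real.log_div hY0.ne' hn0.ne', hY, Real.log_rpow (by positivity)]
      have := Real.log_le_self (by positivity : 0 ≤ 1 + y)
      nlinarith
    have hNc : N * (Y / n) ≤ 2 * ρ * Y := by
      have hNn : N / n ≤ 2 * ρ := by
        rw [hρ, ← mul_div_assoc]
        gcongr
        nlinarith
      calc N * (Y / n) = N / n * Y := by ring
        _ ≤ _ := by gcongr
    have hlow : ∀ z : Fin n → EuclideanSpace ℝ (Fin d),
        ‖scoreEstimator d n t z x - smoothedScore ν t x‖ ^ 2 * (N * u) ≤
        (4 * ((6 + 2 * q) * D + 4) + 152 * D) / t * ℓ * ρ * Z := fun z => by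
      have h3 := norm_sub_sq_mul_le_of_entropy ht ν hn z x hc
      exact entropy_error_arith ht hN hu hl hρ0 hq hD0 hy hZ0 hYZ' hYZ h3 hlogc hNc h2
    refine (lintegral_mono fun z => ENNReal.ofReal_le_ofReal (hlow z)).trans ?_
    rw [lintegral_const, measure_univ, mul_one]

end Pointwise

/-- Scaling of Lebesgue measure; this produces the volume factor r^d in the rate. -/
lemma lintegral_one_add_norm_div {d : ℕ} (s : ℝ) {r : ℝ} (hr : 0 < r) :
    ∫⁻ x : EuclideanSpace ℝ (Fin d), ENNReal.ofReal ((1 + ‖x‖ / r) ^ (-s)) =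
      ENNReal.ofReal (r ^ d) * ∫⁻ x : EuclideanSpace ℝ (Fin d), ENNReal.ofReal ((1 + ‖x‖) ^ (-s)) := by
  have h := Measure.map_addHaar_smul (volume : Measure (EuclideanSpace ℝ (Fin d)))
    (inv_ne_zero hr.ne')
  have hm : Measurable fun x : EuclideanSpace ℝ (Fin d) => ENNReal.ofReal ((1 + ‖x‖) ^ (-s)) := by
    fun_prop
  have h2 := lintegral_map (μ := volume) hm (measurable_const_smul r⁻¹)
  rw [h, lintegral_smul_measure, finrank_euclideanSpace_fin] at h2
  have h3 : |(r⁻¹ ^ d)⁻¹| = r ^ d := by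
    rw [inv_pow, inv_inv, abs_of_pos (by positivity)]
  rw [h3, smul_eq_mul] at h2
  rw [h2]
  refine lintegral_congr fun x => ?_
  rw [norm_smul, Real.norm_of_nonneg (by positivity), inv_mul_eq_div]

/-! ### Integration in time -/

section TimeIntegral

lemma lintegral_rpow_neg_Icc_le {a s : ℝ} (ha : 0 < a) (hs : 0 < s) (S : ℝ) :
    ∫⁻ t in Set.Icc s S, ENNReal.ofReal (t ^ (-a - 1)) ≤ ENNReal.ofReal (s ^ (-a) / a) := by
  have hi := integrableOn_Ioi_rpow_of_lt (by linarith : -a - 1 < -1) hs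
  have hI := integral_Ioi_rpow_of_lt (by linarith : -a - 1 < -1) hs
  calc ∫⁻ t in Set.Icc s S, ENNReal.ofReal (t ^ (-a - 1))
      ≤ ∫⁻ t in Set.Ici s, ENNReal.ofReal (t ^ (-a - 1)) :=
        lintegral_mono_set Set.Icc_subset_Ici_self
    _ = ∫⁻ t in Set.Ioi s, ENNReal.ofReal (t ^ (-a - 1)) :=
        setLIntegral_congr Ioi_ae_eq_Ici.symm
    _ = ENNReal.ofReal (∫ t in Set.Ioi s, t ^ (-a - 1)) := by
        refine (ofReal_integral_eq_lintegral_ofReal hi ?_).symm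
        filter_upwards [ae_restrict_mem measurableSet_Ioi] with t ht
        exact Real.rpow_nonneg (hs.trans ht).le _
    _ = ENNReal.ofReal (s ^ (-a) / a) := by
        rw [hI]
        congr 1
        rw [show -a - 1 + 1 = -a by ring, div_neg, neg_div, neg_neg]

lemma lintegral_one_div_Icc_le {s S : ℝ} (hs : 0 < s) (hS : s ≤ S) :
    ∫⁻ t in Set.Icc s S, ENNReal.ofReal (1 / t) ≤ ENNReal.ofReal (Real.log (S / s)) := by
  have hi : IntegrableOn (fun t : ℝ => 1 / t) (Set.Icc s S) := by
    refine ContinuousOn.integrableOn_Icc (continuousOn_const.div continuousOn_id fun t ht => ?_)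
    exact (hs.trans_le ht.1).ne'
  rw [← ofReal_integral_eq_lintegral_ofReal hi, integral_Icc_eq_integral_Ioc,
    ← intervalIntegral.integral_of_le hS, integral_one_div_of_pos hs (hs.trans_le hS)]
  filter_upwards [ae_restrict_mem measurableSet_Icc] with t ht
  exact one_div_nonneg.2 (hs.le.trans ht.1)

/-- The integrand is t^(-a-1) before time 1 and 1/t after it, giving a power of t₀ and a logarithm
of T. Since (max(1,t₀)/t₀)^a ≥ 1, both fit in one product. -/
lemma lintegral_max_div_rpow_div_le {a t₀ : ℝ} (ha : 0 < a) (ht₀ : 0 < t₀) (T : ℝ) :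
    ∫⁻ t in Set.Icc t₀ T, ENNReal.ofReal ((max 1 t / t) ^ a / t) ≤
      ENNReal.ofReal ((1 + 1 / a) * ((1 + Real.log (max 1 T)) * max 1 t₀ ^ a * t₀ ^ (-a))) := by
  have hsub : Set.Icc t₀ T ⊆ Set.Icc t₀ 1 ∪ Set.Icc (max 1 t₀) T := fun t ht => by
    rcases le_total t 1 with h | h
    · exact Or.inl ⟨ht.1, h⟩
    · exact Or.inr ⟨max_le h ht.1, ht.2⟩
  have hlog : 0 ≤ Real.log (max 1 T) := Real.log_nonneg (le_max_left _ _)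
  have h1 : ∫⁻ t in Set.Icc t₀ 1, ENNReal.ofReal ((max 1 t / t) ^ a / t) ≤
      ENNReal.ofReal (t₀ ^ (-a) / a) := by
    refine le_trans (setLIntegral_mono' measurableSet_Icc fun t ht => ?_)
      (lintegral_rpow_neg_Icc_le ha ht₀ 1)
    have ht0 : 0 < t := ht₀.trans_le ht.1
    rw [max_eq_left ht.2, Real.rpow_sub_one ht0.ne', Real.rpow_neg ht0.le, one_div,
      Real.inv_rpow ht0.le]
  have h2 : ∫⁻ t in Set.Icc (max 1 t₀) T, ENNReal.ofReal ((max 1 t / t) ^ a / t) ≤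
      ENNReal.ofReal (Real.log (max 1 T)) := by
    rcases lt_or_ge T (max 1 t₀) with h | h
    · rw [Set.Icc_eq_empty_of_lt h]
      simp
    · have hm : 0 < max 1 t₀ := lt_max_of_lt_left one_pos
      have hT0 : 0 < T := hm.trans_le h
      calc _ ≤ ∫⁻ t in Set.Icc (max 1 t₀) T, ENNReal.ofReal (1 / t) := by
            refine setLIntegral_mono' measurableSet_Icc fun t ht => ?_
            have h1t : 1 ≤ t := (le_max_left _ _).trans ht.1
            rw [max_eq_right h1t, div_self (by positivity), Real.one_rpow]
        _ ≤ ENNReal.ofReal (Real.log (T / max 1 t₀)) := lintegral_one_div_Icc_le hm h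
        _ ≤ _ := by
            refine ENNReal.ofReal_le_ofReal (Real.log_le_log (by positivity) ?_)
            exact (div_le_self hT0.le (le_max_left _ _)).trans (le_max_right _ _)
  refine (lintegral_mono_set hsub).trans ((lintegral_union_le _ _ _).trans
    ((add_le_add h1 h2).trans ?_))
  rw [← ENNReal.ofReal_add (by positivity) hlog]
  refine ENNReal.ofReal_le_ofReal ?_
  have hQ : t₀ ^ (-a) ≤ max 1 t₀ ^ a * t₀ ^ (-a) :=
    le_mul_of_one_le_left (by positivity) (Real.one_le_rpow (le_max_left _ _) ha.le)
  have hQ1 : 1 ≤ max 1 t₀ ^ a * t₀ ^ (-a) := by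
    rw [Real.rpow_neg ht₀.le, ← div_eq_mul_inv, one_le_div (by positivity)]
    gcongr
    exact le_max_right _ _
  rw [mul_assoc (1 + Real.log _)]
  set Q := max 1 t₀ ^ a * t₀ ^ (-a)
  set l := Real.log (max 1 T)
  have h3 : t₀ ^ (-a) / a ≤ 1 / a * Q := by
    rw [one_div_mul_eq_div]
    gcongr
  have h4 : l ≤ l * Q := le_mul_of_one_le_right hlog hQ1
  have h5 : 0 ≤ 1 / a * (l * Q) := by positivity
  nlinarith

end TimeIntegral

/-! ### Joint measurability, for Tonelli and for transfer to the law of the sample -/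

section Measurability

variable {d n : ℕ} {t : ℝ} (ν : Measure (EuclideanSpace ℝ (Fin d))) [IsProbabilityMeasure ν]

lemma measurable_gaussMass : Measurable (gaussMass ν t) := by
  refine StronglyMeasurable.measurable ?_
  exact StronglyMeasurable.integral_prod_right
    (f := fun x y : EuclideanSpace ℝ (Fin d) => gaussWeight t (x - y))
    (Continuous.stronglyMeasurable (by fun_prop))

lemma measurable_gaussMoment : Measurable (gaussMoment ν t) := by
  refine StronglyMeasurable.measurable ?_
  exact StronglyMeasurable.integral_prod_right
    (f := fun x y : EuclideanSpace ℝ (Fin d) => gaussWeight t (x - y) • (y - x))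
    (Continuous.stronglyMeasurable (by fun_prop))

lemma measurable_smoothedScore : Measurable (smoothedScore ν t) :=
  ((measurable_gaussMass ν).const_mul t).inv.smul (measurable_gaussMoment ν)

lemma measurable_scoreEstimator (ht : 0 < t) (hn : 2 ≤ n) :
    Measurable fun p : (Fin n → EuclideanSpace ℝ (Fin d)) × EuclideanSpace ℝ (Fin d) =>
      scoreEstimator d n t p.1 p.2 := by
  simp_rw [scoreEstimator_eq ht hn]
  have hW : Measurable fun p : (Fin n → EuclideanSpace ℝ (Fin d)) × EuclideanSpace ℝ (Fin d) =>
      weightSum t p.1 p.2 := by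
    unfold weightSum
    exact Continuous.measurable (by fun_prop)
  have hM : Measurable fun p : (Fin n → EuclideanSpace ℝ (Fin d)) × EuclideanSpace ℝ (Fin d) =>
      momentSum t p.1 p.2 := by
    unfold momentSum
    exact Continuous.measurable (by fun_prop)
  exact Measurable.ite (measurableSet_le measurable_const hW)
    ((hW.const_mul t).inv.smul hM) measurable_const

lemma measurable_weighted_error (ht : 0 < t) (hn : 2 ≤ n) :
    Measurable fun p : (Fin n → EuclideanSpace ℝ (Fin d)) × EuclideanSpace ℝ (Fin d) =>
      ENNReal.ofReal (‖scoreEstimator d n t p.1 p.2 - smoothedScore ν t p.2‖ ^ 2 *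
        (heatConst d t * gaussMass ν t p.2)) := by
  have h1 := measurable_scoreEstimator (d := d) ht hn
  have h2 : Measurable fun p : (Fin n → EuclideanSpace ℝ (Fin d)) × EuclideanSpace ℝ (Fin d) =>
      smoothedScore ν t p.2 := (measurable_smoothedScore ν).comp measurable_snd
  have h3 : Measurable fun p : (Fin n → EuclideanSpace ℝ (Fin d)) × EuclideanSpace ℝ (Fin d) =>
      gaussMass ν t p.2 := (measurable_gaussMass ν).comp measurable_snd
  exact (((h1.sub h2).norm.pow_const 2).mul (h3.const_mul _)).ennreal_ofReal

end Measurability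

/-! ### The convergence rate and the error at a fixed time -/

section Rate

lemma threshold_pos (d : ℕ) {n : ℕ} (hn : 2 ≤ n) {t : ℝ} (ht : 0 < t) : 0 < threshold d n t := by
  have hl := one_half_lt_log hn
  have hn0 : (0 : ℝ) < n := by positivity
  have : 0 < Real.log n := by linarith
  unfold threshold
  positivity

/-- The optimal length scale converts the threshold into the convergence rate. -/
lemma threshold_mul_pow_le {d n : ℕ} {γ t : ℝ} (hγ : 0 < γ) (hn : 2 ≤ n) (ht : 0 < t) :
    threshold d n t * ((max 1 t ^ ((1 + γ) / 2) / threshold d n t) ^ (1 + γ + d)⁻¹) ^ d ≤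
      Real.log n ^ ((γ + 1) / (d + γ + 1)) * (n : ℝ) ^ (-((γ + 1) / (d + γ + 1))) *
        (max 1 t / t) ^ (d * (γ + 1) / (2 * (d + γ + 1))) := by
  have hρ := threshold_pos d hn ht
  have hl := one_half_lt_log hn
  have hl0 : 0 < Real.log n := by linarith
  have hn0 : (0 : ℝ) < n := by positivity
  have hm : 0 < max 1 t := lt_max_of_lt_left one_pos
  set b := (γ + 1) / (d + γ + 1) with hb
  set a := d * (γ + 1) / (2 * (d + γ + 1)) with ha
  have hb0 : 0 < b := by positivity
  have hle : threshold d n t ≤ Real.log n * (n : ℝ)⁻¹ * t ^ (-((d : ℝ) / 2)) := by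
    rw [threshold, Real.rpow_neg ht.le, ← div_div, div_eq_mul_inv (Real.log n / n),
      div_eq_mul_inv (Real.log n)]
    gcongr
    nlinarith [Real.pi_gt_three]
  have heq : threshold d n t *
      ((max 1 t ^ ((1 + γ) / 2) / threshold d n t) ^ (1 + γ + d)⁻¹) ^ d =
      threshold d n t ^ b * max 1 t ^ a := by
    rw [← Real.rpow_natCast, ← Real.rpow_mul (by positivity), Real.div_rpow (by positivity) hρ.le,
      ← Real.rpow_mul hm.le, mul_div_assoc', mul_div_right_comm]
    congr 1
    · rw [div_eq_mul_inv, ← Real.rpow_neg hρ.le]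
      have := Real.rpow_add hρ 1 (-((1 + γ + d)⁻¹ * d))
      rw [Real.rpow_one] at this
      rw [← this]
      congr 1
      rw [hb]
      field_simp
      ring
    · congr 1
      rw [ha]
      field_simp
      ring
  rw [heq]
  calc threshold d n t ^ b * max 1 t ^ a ≤
      (Real.log n * (n : ℝ)⁻¹ * t ^ (-((d : ℝ) / 2))) ^ b * max 1 t ^ a := by gcongr
    _ = Real.log n ^ b * (n : ℝ) ^ (-b) * (max 1 t / t) ^ a := by
      rw [Real.mul_rpow (by positivity) (by positivity), Real.mul_rpow hl0.le (by positivity),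
        Real.inv_rpow hn0.le, ← Real.rpow_neg hn0.le, ← Real.rpow_mul ht.le,
        Real.div_rpow hm.le ht.le, div_eq_mul_inv (max 1 t ^ a), ← Real.rpow_neg ht.le]
      have : -((d : ℝ) / 2) * b = -a := by
        rw [hb, ha]
        field_simp
      rw [this]
      ring

end Rate

/-- Expected score error at a fixed time. -/
lemma exists_lintegral_score_error_le (d : ℕ) {γ C₂ : ℝ} (hγ : 0 < γ) (hC₂ : 0 < C₂) :
    ∃ C₃ : ℝ, 0 < C₃ ∧ ∀ (β L : ℝ) (p₀ : EuclideanSpace ℝ (Fin d) → ℝ),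
      PolynomialTail d γ C₂ p₀ → SobolevDensity d β L p₀ → ∀ n : ℕ, 2 ≤ n → ∀ t : ℝ, 0 < t →
      ∫⁻ z, ∫⁻ x, ENNReal.ofReal
          (‖scoreEstimator d n t z x - score d p₀ t x‖ ^ 2 * diffusedDensity d p₀ t x)
          ∂volume ∂(Measure.pi fun _ => densityMeasure d p₀) ≤
        ENNReal.ofReal (C₃ * Real.log n ^ (1 + (γ + 1) / (d + γ + 1)) *
          (n : ℝ) ^ (-((γ + 1) / (d + γ + 1))) *
          ((max 1 t / t) ^ (d * (γ + 1) / (2 * (d + γ + 1))) / t)) := by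
  obtain ⟨C₁, hC₁, htail⟩ := exists_diffusedDensity_tail d hγ hC₂
  set q := 1 + γ + d with hq
  have hq1 : 1 ≤ q := by
    have : (0 : ℝ) ≤ d := by positivity
    linarith
  set A := 4 * ((6 + 2 * q) * (2 ^ q * (2 + C₁)) + 4) + 152 * (2 ^ q * (2 + C₁))
  have hA : 0 < A := by positivity
  set J := ∫⁻ x : EuclideanSpace ℝ (Fin d), ENNReal.ofReal ((1 + ‖x‖) ^ (-(q - 1))) with hJ_def
  have hJ : J < ∞ := finite_integral_one_add_norm (by
    rw [finrank_euclideanSpace_fin, hq]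
    linarith)
  obtain ⟨j, hj0, hj⟩ : ∃ j : ℝ, 0 ≤ j ∧ J = ENNReal.ofReal j :=
    ⟨J.toReal, ENNReal.toReal_nonneg, (ENNReal.ofReal_toReal hJ.ne).symm⟩
  -- j + 1 in place of j makes the constant positive from j ≥ 0 alone.
  refine ⟨A * (j + 1), by positivity, fun β L p₀ ht0 hp n hn t ht => ?_⟩
  have hν := hp.isProbabilityMeasure
  set ν := densityMeasure d p₀
  -- Up to the factor C₁, the radius at which the tail bound on the diffused density falls to the
  -- threshold.
  set r := (max 1 t ^ ((1 + γ) / 2) / threshold d n t) ^ q⁻¹ with hr_def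
  have hρ := threshold_pos d hn ht
  have hm : 0 < max 1 t := lt_max_of_lt_left one_pos
  have hr : 0 < r := by positivity
  have hl := one_half_lt_log hn
  have hl0 : 0 < Real.log n := by linarith
  have hn0 : (0 : ℝ) < n := by positivity
  have hrq : C₁ * threshold d n t * r ^ q = C₁ * max 1 t ^ ((1 + γ) / 2) := by
    rw [hr_def, Real.rpow_inv_rpow (by positivity) (by positivity)]
    field_simp
  simp_rw [hp.score_eq ht, hp.diffusedDensity_eq t]
  rw [lintegral_lintegral_swap (measurable_weighted_error ν ht hn).aemeasurable]
  have hpt : ∀ x, ∫⁻ z, ENNReal.ofReal (‖scoreEstimator d n t z x - smoothedScore ν t x‖ ^ 2 *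
        (heatConst d t * gaussMass ν t x)) ∂(Measure.pi fun _ => ν) ≤
      ENNReal.ofReal (A / t * Real.log n * threshold d n t) *
        ENNReal.ofReal ((1 + ‖x‖ / r) ^ (-(q - 1))) := fun x => by
    rw [← ENNReal.ofReal_mul (by positivity)]
    refine lintegral_norm_sub_sq_mul_le ν ht hn hq1 hC₁ hr x ?_
    rw [← hp.diffusedDensity_eq, hrq]
    exact htail β L p₀ ht0 hp t ht x
  refine (lintegral_mono hpt).trans ?_
  rw [lintegral_const_mul' _ _ ENNReal.ofReal_ne_top, lintegral_one_add_norm_div _ hr, ← hJ_def, hj,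
    ← ENNReal.ofReal_mul (by positivity),
    ← ENNReal.ofReal_mul (by positivity)]
  refine ENNReal.ofReal_le_ofReal ?_
  have hrate := threshold_mul_pow_le (d := d) hγ hn ht
  rw [← hq, ← hr_def] at hrate
  set b := (γ + 1) / (d + γ + 1)
  set a := d * (γ + 1) / (2 * (d + γ + 1))
  rw [Real.rpow_add hl0, Real.rpow_one]
  calc _ = A / t * Real.log n * j * (threshold d n t * r ^ d) := by ring
    _ ≤ A / t * Real.log n * (j + 1) *
        (Real.log n ^ b * (n : ℝ) ^ (-b) * (max 1 t / t) ^ a) := by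
      gcongr
      linarith
    _ = _ := by ring

end ScoreEstimation
end

theorem theorem2 (d : ℕ) (hd : 1 ≤ d) (γ C₂ : ℝ) (hγ : 0 < γ) (hC₂ : 0 < C₂) :
    ∃ C K : ℝ, 0 < C ∧ 0 < K ∧
      ∀ (β L : ℝ), 0 < β → 0 < L →
      ∀ p₀ : EuclideanSpace ℝ (Fin d) → ℝ,
        ScoreEstimation.PolynomialTail d γ C₂ p₀ →
        ScoreEstimation.SobolevDensity d β L p₀ →
      ∀ (n : ℕ), 2 ≤ n →
      ∀ (Ω : Type*) [MeasurableSpace Ω] (P : Measure Ω) [IsProbabilityMeasure P]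
        (X : Fin n → Ω → EuclideanSpace ℝ (Fin d)),
        iIndepFun X P →
        (∀ i, HasLaw (X i) (ScoreEstimation.densityMeasure d p₀) P) →
      ∀ (t₀ T : ℝ), 0 < t₀ → t₀ < T →
        ScoreEstimation.integratedScoreError d n p₀ P X t₀ T ≤
          ENNReal.ofReal
            (C * ((1 + Real.log (max 1 T)) * max 1 t₀ ^ (d * (γ + 1) / (2 * (d + γ + 1))))
              * Real.log n ^ K
              * (n : ℝ) ^ (-((γ + 1) / (d + γ + 1)))
              * t₀ ^ (-(d * (γ + 1) / (2 * (d + γ + 1))))) := by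
  obtain ⟨C₃, hC₃, hbound⟩ := ScoreEstimation.exists_lintegral_score_error_le d hγ hC₂
  have hd0 : (0 : ℝ) < d := by exact_mod_cast hd
  set b := (γ + 1) / (d + γ + 1)
  set a := d * (γ + 1) / (2 * (d + γ + 1))
  have ha : 0 < a := by positivity
  -- In K = 1 + b, the 1 is the logarithm in the pointwise error bound and b comes from the log n in
  -- ρ_n, raised to the power b.
  refine ⟨C₃ * (1 + 1 / a), 1 + b, by positivity, by positivity, ?_⟩
  intro β L _ _ p₀ htail hp n hn Ω _ P _ X hX hlaw t₀ T ht₀ _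
  have hν := hp.isProbabilityMeasure
  -- Independence and the common law replace the abstract sample space by a product measure.
  have hmap : P.map (fun ω i => X i ω) =
      Measure.pi fun _ => ScoreEstimation.densityMeasure d p₀ := by
    rw [(iIndepFun_iff_map_fun_eq_pi_map fun i => (hlaw i).aemeasurable).1 hX]
    simp_rw [(hlaw _).map_eq]
  have hXm : AEMeasurable (fun ω i => X i ω) P :=
    aemeasurable_pi_lambda _ fun i => (hlaw i).aemeasurable
  have htime : ∀ t ∈ Set.Icc t₀ T, ∫⁻ ω, ∫⁻ x, ENNReal.ofReal
        (‖ScoreEstimation.scoreEstimator d n t (fun i => X i ω) x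
          - ScoreEstimation.score d p₀ t x‖ ^ 2
          * ScoreEstimation.diffusedDensity d p₀ t x) ∂volume ∂P ≤
      ENNReal.ofReal (C₃ * Real.log n ^ (1 + b) * (n : ℝ) ^ (-b)) *
        ENNReal.ofReal ((max 1 t / t) ^ a / t) := fun t ht => by
    have ht0 : 0 < t := ht₀.trans_le ht.1
    rw [← ENNReal.ofReal_mul (by positivity)]
    refine le_trans (le_of_eq ?_) (hbound β L p₀ htail hp n hn t ht0)
    simp_rw [hp.score_eq ht0, hp.diffusedDensity_eq t]
    rw [← hmap, lintegral_map' _ hXm]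
    exact (ScoreEstimation.measurable_weighted_error _ ht0 hn).lintegral_prod_right'.aemeasurable
  refine (setLIntegral_mono' measurableSet_Icc htime).trans ?_
  rw [lintegral_const_mul' _ _ ENNReal.ofReal_ne_top]
  refine (mul_le_mul_right (ScoreEstimation.lintegral_max_div_rpow_div_le ha ht₀ T) _).trans ?_
  rw [← ENNReal.ofReal_mul (by positivity)]
  refine le_of_eq (congrArg ENNReal.ofReal ?_)
  ring
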